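/- Let $0<q<1$. Let $\mathcal A(SU_q(2))$ be the $*$-algebra over $\mathbb C$ generated by $a,c$ with relations $ac=qca$, $ac^*=qc^*a$, $cc^*=c^*c$, $a^*a+c^*c=aa^*+q^2cc^*=1$, with coproduct $\Delta$ determined by $\Delta U=U\otimes U$ for $U=\begin{pmatrix}a&-qc^*\\c&a^*\end{pmatrix}$. The elements $K,E,F$ of the quantized enveloping algebra $\mathcal U_q(su(2))$ act from the left by $h\triangleright x=x_{(1)}\langle h,x_{(2)}\rangle$, where $K$ is group-like, $\Delta E=E\otimes K+K^{-1}\otimes E$, $\Delta F=F\otimes K+K^{-1}\otimes F$, and the pairing on generators is $\langle K,a\rangle=q^{-1/2}$, $\langle K,a^*\rangle=q^{1/2}$, $\langle E,c\rangle=1$, $\langle F,c^*\rangle=-q^{-1}$, all other pairings of $K,E,F$ with $a,a^*,c,c^*$ being $0$. Put $X_+=q^{1/2}EK$, $X_-=q^{-1/2}FK$, $X_z=(1-K^4)/(1-q^{-2})$. Let $\mathcal A=\mathcal A(\mathbb{CP}^1_q)$ be the subalgebra of invariants of the $U(1)$-action $a\mapsto ua$, $c\mapsto uc$, $a^*\mapsto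 \bar u a^*$, $c^*\mapsto \bar u c^*$, and for $n\in\mathbb Z$ let $\mathcal L_n=\{x\in\mathcal A(SU_q(2)) : K\triangleright x=q^{n/2}x\}$. The three-dimensional left-covariant calculus $(\Omega^\bullet(SU_q(2)),\mathrm d)$ is the free left $\mathcal A(SU_q(2))$-module with basis $1,\ \omega_-,\ \omega_+,\ \omega_z,\ \omega_-\wedge\omega_+,\ \omega_-\wedge\omega_z,\ \omega_+\wedge\omega_z,\ \omega_-\wedge\omega_+\wedge\omega_z$, with $\omega_\pm f=(K^2\triangleright f)\omega_\pm$, $\omega_zf=(K^4\triangleright f)\omega_z$, $\omega_\pm\wedge\omega_\pm=\omega_z\wedge\omega_z=0$, $\omega_-\wedge\omega_++q^{-2}\omega_+\wedge\omega_-=0$, $\omega_z\wedge\omega_\mp+q^{\pm4}\omega_\mp\wedge\omega_z=0$; $\mathrm df=(X_+\triangleright f)\omega_++(X_-\triangleright f)\omega_-+(X_z\triangleright f)\omega_z$, $\mathrm d\omega_z=-\omega_-\wedge\omega_+$, $\mathrm d\omega_+=q^2(1+q^2)\omega_z\wedge\omega_+$, $\mathrm d\omega_-=-(1+q^{-2})\omega_z\wedge\omega_-$,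 extended by the graded Leibniz rule; involution $\omega_-^*=-\omega_+$, $\omega_z^*=-\omega_z$, $(\alpha\wedge\beta)^*=(-1)^{|\alpha||\beta|}\beta^*\wedge\alpha^*$; and left coaction $\Delta_L(f\omega)=\Delta(f)(1\otimes\omega)$ for every $\omega$ in the basis above. Let $\Omega^\bullet(\mathbb{CP}^1_q)$ be its restriction to $\mathbb{CP}^1_q$: $\Omega^n(\mathbb{CP}^1_q)$ is the linear span of the forms $f\,\mathrm dg_1\wedge\dots\wedge\mathrm dg_n$ with $f,g_1,\dots,g_n\in\mathcal A$. Put $\partial f=(X_+\triangleright f)\omega_+$ and $\bar\partial f=(X_-\triangleright f)\omega_-$ for $f\in\mathcal A$, and let $\Omega^{(1,0)}$ and $\Omega^{(0,1)}$ be the $\mathcal A$-bimodules generated by $\partial\mathcal A$ and by $\bar\partial\mathcal A$. **Proposition.** $(\Omega^\bullet(\mathbb{CP}^1_q),\mathrm d)$ is a left-covariant differential $*$-calculus on $\mathcal A$, and $$\Omega^\bullet(\mathbb{CP}^1_q)=\mathcal A\oplus\left(\mathcal L_{-2}\,\omega_-\oplus\mathcal L_{2}\,\omega_+\right)\oplus\mathcal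 A\,\omega_-\wedge\omega_+ ,$$ the summands being the components of degree $0$, $1$ and $2$, all higher components vanishing. Moreover $\Omega^{(1,0)}=\mathcal L_2\,\omega_+$ and $\Omega^{(0,1)}=\mathcal L_{-2}\,\omega_-$, and with $\Omega^{(0,0)}=\mathcal A$, $\Omega^{(1,1)}=\Omega^2(\mathbb{CP}^1_q)$, all other $\Omega^{(p,r)}=0$, and $\partial,\bar\partial$ extended to forms by $\partial(x\omega_-)=(X_+\triangleright x)\,\omega_+\wedge\omega_-$, $\bar\partial(y\omega_+)=(X_-\triangleright y)\,\omega_-\wedge\omega_+$ for $x\in\mathcal L_{-2}$, $y\in\mathcal L_2$ and by $0$ on $\Omega^{(1,0)}$, respectively on $\Omega^{(0,1)}$, and on $\Omega^{(1,1)}$, this is a complex structure for the calculus. That is: $\Omega^{(\bullet,\bullet)}$ is a bigraded algebra; $\partial$ and $\bar\partial$ are of bidegree $(1,0)$ and $(0,1)$, square to zero and satisfy the graded Leibniz rule; $\Omega^n(\mathbb{CP}^1_q)=\bigoplus_{p+r=n}\Omega^{(p,r)}$; $\mathrm d=\partial+\bar\partial$; the involution maps $\Omega^{(p,r)}$ to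 $\Omega^{(r,p)}$; and $(\partial\alpha)^*=\bar\partial(\alpha^*)$ for all forms $\alpha$. -/

import Mathlib

open scoped TensorProduct ComplexConjugate

set_option linter.unusedSimpArgs false
set_option linter.unnecessarySeqFocus false

namespace QuantumProjectiveLine

/-! ## The coordinate algebra of quantum `SU(2)` -/

/-- The four generators `a, a^*, c, c^*`. -/
inductive Gen
  | a | as | c | cs
  deriving DecidableEq

/-- The defining relations (together with their adjoints) of the `*`-algebra generated by
`a` and `c`. -/
inductive Rel (q : Set.Ioo (0 : ℝ) 1) : FreeAlgebra ℂ Gen → FreeAlgebra ℂ Gen → Prop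
  | ac : Rel q (FreeAlgebra.ι ℂ Gen.a * FreeAlgebra.ι ℂ Gen.c)
      (((q : ℝ) : ℂ) • (FreeAlgebra.ι ℂ Gen.c * FreeAlgebra.ι ℂ Gen.a))
  | acs : Rel q (FreeAlgebra.ι ℂ Gen.a * FreeAlgebra.ι ℂ Gen.cs)
      (((q : ℝ) : ℂ) • (FreeAlgebra.ι ℂ Gen.cs * FreeAlgebra.ι ℂ Gen.a))
  | csas : Rel q (FreeAlgebra.ι ℂ Gen.cs * FreeAlgebra.ι ℂ Gen.as)
      (((q : ℝ) : ℂ) • (FreeAlgebra.ι ℂ Gen.as * FreeAlgebra.ι ℂ Gen.cs))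
  | cas : Rel q (FreeAlgebra.ι ℂ Gen.c * FreeAlgebra.ι ℂ Gen.as)
      (((q : ℝ) : ℂ) • (FreeAlgebra.ι ℂ Gen.as * FreeAlgebra.ι ℂ Gen.c))
  | ccs : Rel q (FreeAlgebra.ι ℂ Gen.c * FreeAlgebra.ι ℂ Gen.cs)
      (FreeAlgebra.ι ℂ Gen.cs * FreeAlgebra.ι ℂ Gen.c)
  | asa : Rel q (FreeAlgebra.ι ℂ Gen.as * FreeAlgebra.ι ℂ Gen.a
      + FreeAlgebra.ι ℂ Gen.cs * FreeAlgebra.ι ℂ Gen.c) 1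
  | aas : Rel q (FreeAlgebra.ι ℂ Gen.a * FreeAlgebra.ι ℂ Gen.as
      + (((q : ℝ) : ℂ) ^ 2) • (FreeAlgebra.ι ℂ Gen.c * FreeAlgebra.ι ℂ Gen.cs)) 1

/-- The coordinate algebra `A(SU_q(2))`. -/
def ASU (q : Set.Ioo (0 : ℝ) 1) : Type := RingQuot (Rel q)

namespace ASU

variable (q : Set.Ioo (0 : ℝ) 1)

instance : Ring (ASU q) := inferInstanceAs (Ring (RingQuot (Rel q)))
instance : Algebra ℂ (ASU q) := inferInstanceAs (Algebra ℂ (RingQuot (Rel q)))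

/-- The quotient map from the free algebra. -/
def proj : FreeAlgebra ℂ Gen →ₐ[ℂ] ASU q := RingQuot.mkAlgHom ℂ (Rel q)

/-- The class of a generator. -/
def gen (g : Gen) : ASU q := proj q (FreeAlgebra.ι ℂ g)

/-- The parameter as a complex number. -/
def Q : ℂ := ((q : ℝ) : ℂ)

theorem Q_ne : Q q ≠ 0 := by
  have h := q.2.1
  simp only [Q, ne_eq, Complex.ofReal_eq_zero]
  exact h.ne'

theorem conj_Q : conj (Q q) = Q q := Complex.conj_ofReal _

/-- The positive square root of the parameter. -/
noncomputable def sq : ℂ := ((Real.sqrt (q : ℝ) : ℝ) : ℂ)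

theorem sq_mul : sq q * sq q = Q q := by
  have h := q.2.1
  rw [sq, Q, ← Complex.ofReal_mul, Real.mul_self_sqrt h.le]

theorem sq_ne : sq q ≠ 0 := by
  intro h
  apply Q_ne q
  rw [← sq_mul, h, zero_mul]

variable {q}

theorem rel {x y : FreeAlgebra ℂ Gen} (h : Rel q x y) : proj q x = proj q y :=
  RingQuot.mkAlgHom_rel ℂ h

theorem r_ac : gen q .a * gen q .c = Q q • (gen q .c * gen q .a) := by
  have h := rel (Rel.ac (q := q))
  simp only [map_add, map_mul, map_one, map_smul] at h
  exact h
theorem r_acs : gen q .a * gen q .cs = Q q • (gen q .cs * gen q .a) := by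
  have h := rel (Rel.acs (q := q))
  simp only [map_add, map_mul, map_one, map_smul] at h
  exact h
theorem r_csas : gen q .cs * gen q .as = Q q • (gen q .as * gen q .cs) := by
  have h := rel (Rel.csas (q := q))
  simp only [map_add, map_mul, map_one, map_smul] at h
  exact h
theorem r_cas : gen q .c * gen q .as = Q q • (gen q .as * gen q .c) := by
  have h := rel (Rel.cas (q := q))
  simp only [map_add, map_mul, map_one, map_smul] at h
  exact h
theorem r_ccs : gen q .c * gen q .cs = gen q .cs * gen q .c := by
  have h := rel (Rel.ccs (q := q))
  simp only [map_add, map_mul, map_one, map_smul] at h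
  exact h
theorem r_asa : gen q .as * gen q .a + gen q .cs * gen q .c = 1 := by
  have h := rel (Rel.asa (q := q))
  simp only [map_add, map_mul, map_one, map_smul] at h
  exact h
theorem r_aas : gen q .a * gen q .as + (Q q ^ 2) • (gen q .c * gen q .cs) = 1 := by
  have h := rel (Rel.aas (q := q))
  simp only [map_add, map_mul, map_one, map_smul] at h
  exact h

/-- A choice of four elements satisfying the defining relations. -/
structure IsRep {B : Type*} [Ring B] [Algebra ℂ B] (q : Set.Ioo (0 : ℝ) 1) (f : Gen → B) :
    Prop where
  ac : f .a * f .c = Q q • (f .c * f .a)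
  acs : f .a * f .cs = Q q • (f .cs * f .a)
  csas : f .cs * f .as = Q q • (f .as * f .cs)
  cas : f .c * f .as = Q q • (f .as * f .c)
  ccs : f .c * f .cs = f .cs * f .c
  asa : f .as * f .a + f .cs * f .c = 1
  aas : f .a * f .as + (Q q ^ 2) • (f .c * f .cs) = 1

/-- The universal property of `A(SU_q(2))`. -/
def lift {B : Type*} [Ring B] [Algebra ℂ B] (f : Gen → B) (hf : IsRep q f) :
    ASU q →ₐ[ℂ] B :=
  RingQuot.liftAlgHom ℂ ⟨FreeAlgebra.lift ℂ f, by
    intro x y h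
    cases h <;> simp only [map_mul, map_add, map_smul, map_one, FreeAlgebra.lift_ι_apply]
    · exact hf.ac
    · exact hf.acs
    · exact hf.csas
    · exact hf.cas
    · exact hf.ccs
    · exact hf.asa
    · exact hf.aas⟩

@[simp] theorem lift_gen {B : Type*} [Ring B] [Algebra ℂ B] (f : Gen → B) (hf : IsRep q f)
    (g : Gen) : lift f hf (gen q g) = f g := by
  refine (RingQuot.liftAlgHom_mkAlgHom_apply ℂ _ _ _).trans ?_
  simp

theorem hom_ext {B : Type*} [Ring B] [Algebra ℂ B] {f g : ASU q →ₐ[ℂ] B}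
    (h : ∀ x, f (gen q x) = g (gen q x)) : f = g := by
  refine RingQuot.ringQuot_ext' ℂ (s := Rel q) (B := B) f g (FreeAlgebra.hom_ext ?_)
  funext x
  exact h x

/-! ### The `*`-structure -/

/-- The opposite algebra with the complex conjugate scalar multiplication. -/
def ConjOp (q : Set.Ioo (0 : ℝ) 1) : Type := (ASU q)ᵐᵒᵖ

instance : Ring (ConjOp q) := inferInstanceAs (Ring (ASU q)ᵐᵒᵖ)

instance : Algebra ℂ (ConjOp q) :=
  RingHom.toAlgebra' ((algebraMap ℂ (ASU q)ᵐᵒᵖ).comp (starRingEnd ℂ)) (by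
    intro z x
    exact Algebra.commutes (A := (ASU q)ᵐᵒᵖ) (starRingEnd ℂ z) x)

/-- The tautological map to the conjugate opposite algebra. -/
def toConj (x : ASU q) : ConjOp q := MulOpposite.op x
/-- The inverse of the tautological map. -/
def ofConj (x : ConjOp q) : ASU q := MulOpposite.unop x

theorem toConj_mul (x y : ASU q) : toConj x * toConj y = toConj (y * x) := rfl
theorem ofConj_mul (x y : ConjOp q) : ofConj (x * y) = ofConj y * ofConj x := rfl
theorem toConj_smul (z : ℂ) (x : ASU q) : z • toConj x = toConj (conj z • x) := by
  rw [Algebra.smul_def, Algebra.smul_def, Algebra.commutes]; rfl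
theorem ofConj_smul (z : ℂ) (x : ConjOp q) : ofConj (z • x) = conj z • ofConj x := by
  rw [Algebra.smul_def, Algebra.smul_def, Algebra.commutes]; rfl

/-- The adjoint of a generator. -/
def Gen.adj : Gen → Gen
  | .a => .as | .as => .a | .c => .cs | .cs => .c

/-- The involution as a homomorphism to the conjugate opposite algebra. -/
def starHom (q : Set.Ioo (0 : ℝ) 1) : ASU q →ₐ[ℂ] ConjOp q :=
  lift (fun g => toConj (gen q (Gen.adj g)))
    { ac := by simp only [Gen.adj, toConj_mul, toConj_smul, conj_Q, r_csas]
      acs := by simp only [Gen.adj, toConj_mul, toConj_smul, conj_Q, r_cas]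
      csas := by simp only [Gen.adj, toConj_mul, toConj_smul, conj_Q, r_ac]
      cas := by simp only [Gen.adj, toConj_mul, toConj_smul, conj_Q, r_acs]
      ccs := by simp only [Gen.adj, toConj_mul, r_ccs]
      asa := by
        simp only [Gen.adj, toConj_mul]
        exact congrArg toConj r_asa
      aas := by
        simp only [Gen.adj, toConj_mul, toConj_smul, map_pow, conj_Q]
        exact congrArg toConj r_aas }

instance : Star (ASU q) := ⟨fun x => ofConj (starHom q x)⟩

theorem star_def (x : ASU q) : star x = ofConj (starHom q x) := rfl

theorem star_gen (g : Gen) : star (gen q g) = gen q (Gen.adj g) := by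
  rw [star_def, starHom, lift_gen]; rfl

theorem star_mul_aux (x y : ASU q) : star (x * y) = star y * star x := by
  rw [star_def, map_mul, ofConj_mul]; rfl
theorem star_add_aux (x y : ASU q) : star (x + y) = star x + star y := by
  rw [star_def, map_add]; rfl
theorem star_smul_aux (z : ℂ) (x : ASU q) : star (z • x) = conj z • star x := by
  rw [star_def, map_smul, ofConj_smul]; rfl
theorem star_one_aux : star (1 : ASU q) = 1 := by
  rw [star_def, map_one]; rfl

/-- An endomorphism of `A(SU_q(2))`, conjugated by the involution. -/
def starConj (φ : ASU q →ₐ[ℂ] ASU q) (hinv : ASU q → ASU q) (h : ∀ x, hinv x = star (φ (star x))) :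
    ASU q →ₐ[ℂ] ASU q where
  toFun := hinv
  map_one' := by rw [h, star_one_aux, map_one, star_one_aux]
  map_mul' x y := by rw [h, h, h, star_mul_aux, map_mul, star_mul_aux]
  map_zero' := by
    rw [h, star_def 0, map_zero, show ofConj (0 : ConjOp q) = 0 from rfl, map_zero,
      star_def 0, map_zero]; rfl
  map_add' x y := by rw [h, h, h, star_add_aux, map_add, star_add_aux]
  commutes' z := by
    rw [h, Algebra.algebraMap_eq_smul_one, star_smul_aux, star_one_aux, map_smul, map_one,
      star_smul_aux, star_one_aux, Complex.conj_conj]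

theorem star_star_aux (x : ASU q) : star (star x) = x := by
  have h : starConj (AlgHom.id ℂ (ASU q)) (fun x => star (star x)) (fun _ => rfl)
      = AlgHom.id ℂ (ASU q) := by
    apply hom_ext
    intro g
    change star (star (gen q g)) = gen q g
    rw [star_gen, star_gen]
    cases g <;> rfl
  exact DFunLike.congr_fun h x

instance : StarRing (ASU q) where
  star_involutive := star_star_aux
  star_mul := star_mul_aux
  star_add := star_add_aux

instance : StarModule ℂ (ASU q) := ⟨fun z x => star_smul_aux z x⟩

/-! ### Coproduct, pairing, and the left action -/

theorem n_asa : gen q .as * gen q .a = 1 - gen q .cs * gen q .c := by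
  rw [← r_asa]; abel
theorem n_aas : gen q .a * gen q .as = 1 - (Q q ^ 2) • (gen q .cs * gen q .c) := by
  rw [← r_aas, r_ccs]; abel

/-- Values of the coproduct on generators. -/
def comulGen (q : Set.Ioo (0 : ℝ) 1) : Gen → ASU q ⊗[ℂ] ASU q
  | .a => gen q .a ⊗ₜ gen q .a - Q q • (gen q .cs ⊗ₜ gen q .c)
  | .as => gen q .as ⊗ₜ gen q .as - Q q • (gen q .c ⊗ₜ gen q .cs)
  | .c => gen q .c ⊗ₜ gen q .a + gen q .as ⊗ₜ gen q .c
  | .cs => gen q .a ⊗ₜ gen q .cs + gen q .cs ⊗ₜ gen q .as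

/-- The coproduct, determined by `Δ U = U ⊗ U` for the defining matrix
`U = ((a, -q c^*), (c, a^*))`. -/
def comul (q : Set.Ioo (0 : ℝ) 1) : ASU q →ₐ[ℂ] ASU q ⊗[ℂ] ASU q :=
  lift (comulGen q) (by
    constructor <;>
    · simp only [comulGen, mul_add, mul_sub, add_mul, sub_mul, smul_mul_assoc, mul_smul_comm,
        Algebra.TensorProduct.tmul_mul_tmul, r_ac, r_acs, r_csas, r_cas, r_ccs, n_asa, n_aas,
        TensorProduct.tmul_sub, TensorProduct.sub_tmul, TensorProduct.tmul_smul,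
        ← TensorProduct.smul_tmul', Algebra.TensorProduct.one_def]
      module)

/-- The character `⟨K, ·⟩`. -/
noncomputable def pairK (q : Set.Ioo (0 : ℝ) 1) : ASU q →ₐ[ℂ] ℂ :=
  lift (fun g => match g with
    | .a => (sq q)⁻¹
    | .as => sq q
    | .c => 0
    | .cs => 0) (by
    have := sq_ne q
    constructor <;> simp [this])

/-- The two-dimensional upper triangular representation
`x ↦ ((⟨K⁻¹, x⟩, ⟨T, x⟩), (0, ⟨K, x⟩))`, whose multiplicativity expresses the coproduct
`Δ T = T ⊗ K + K⁻¹ ⊗ T`, with `⟨T, c⟩ = u`, `⟨T, c^*⟩ = v`, `⟨T, a⟩ = ⟨T, a^*⟩ = 0`. -/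
noncomputable def pairRep (q : Set.Ioo (0 : ℝ) 1) (u v : ℂ) :
    ASU q →ₐ[ℂ] Matrix (Fin 2) (Fin 2) ℂ :=
  lift (fun g => match g with
    | .a => !![sq q, 0; 0, (sq q)⁻¹]
    | .as => !![(sq q)⁻¹, 0; 0, sq q]
    | .c => !![0, u; 0, 0]
    | .cs => !![0, v; 0, 0]) (by
    have := sq_ne q
    constructor <;> ext i j <;> fin_cases i <;> fin_cases j <;>
      simp [this, ← sq_mul] <;> field_simp)

/-- The functional `⟨E, ·⟩`, with `⟨E, c⟩ = 1`. -/
noncomputable def pairE (q : Set.Ioo (0 : ℝ) 1) : ASU q →ₗ[ℂ] ℂ :=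
  (Matrix.entryLinearMap ℂ ℂ 0 1).comp (pairRep q 1 0).toLinearMap

/-- The functional `⟨F, ·⟩`, with `⟨F, c^*⟩ = -q⁻¹`. -/
noncomputable def pairF (q : Set.Ioo (0 : ℝ) 1) : ASU q →ₗ[ℂ] ℂ :=
  (Matrix.entryLinearMap ℂ ℂ 0 1).comp (pairRep q 0 (-(Q q)⁻¹)).toLinearMap

/-- The left action `h ▷ x = x₍₁₎ ⟨h, x₍₂₎⟩` of a functional `h`. -/
noncomputable def act (h : ASU q →ₗ[ℂ] ℂ) : ASU q →ₗ[ℂ] ASU q :=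
  (TensorProduct.rid ℂ (ASU q)).toLinearMap.comp
    ((h.lTensor (ASU q)).comp (comul q).toLinearMap)

/-- The operator `K ▷`, as an algebra endomorphism (`K` is group-like). -/
noncomputable def actK (q : Set.Ioo (0 : ℝ) 1) : ASU q →ₐ[ℂ] ASU q :=
  ((Algebra.TensorProduct.rid ℂ ℂ (ASU q)).toAlgHom.comp
    (Algebra.TensorProduct.map (AlgHom.id ℂ (ASU q)) (pairK q))).comp (comul q)

/-- The operator `E ▷`. -/
noncomputable def actE (q : Set.Ioo (0 : ℝ) 1) : ASU q →ₗ[ℂ] ASU q := act (pairE q)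

/-- The operator `F ▷`. -/
noncomputable def actF (q : Set.Ioo (0 : ℝ) 1) : ASU q →ₗ[ℂ] ASU q := act (pairF q)

/-- `X₊ ▷` with `X₊ = q^{1/2} E K`. -/
noncomputable def Xp (q : Set.Ioo (0 : ℝ) 1) : ASU q →ₗ[ℂ] ASU q :=
  sq q • (actE q).comp (actK q).toLinearMap

/-- `X₋ ▷` with `X₋ = q^{-1/2} F K`. -/
noncomputable def Xm (q : Set.Ioo (0 : ℝ) 1) : ASU q →ₗ[ℂ] ASU q :=
  (sq q)⁻¹ • (actF q).comp (actK q).toLinearMap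

/-- `X_z ▷` with `X_z = (1 - K⁴) / (1 - q⁻²)`. -/
noncomputable def Xz (q : Set.Ioo (0 : ℝ) 1) : ASU q →ₗ[ℂ] ASU q :=
  (1 - (Q q)⁻¹ ^ 2)⁻¹ • (LinearMap.id - (actK q ^ 4).toLinearMap)

/-! ### The `U(1)`-action, the projective line and the line bundles -/

theorem isRep_scale {z w : ℂ} (h : z * w = 1) :
    IsRep q (fun g => match g with
      | .a => z • gen q .a
      | .as => w • gen q .as
      | .c => z • gen q .c
      | .cs => w • gen q .cs) where
  ac := by simp only [smul_mul_assoc, mul_smul_comm, r_ac]; module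
  acs := by simp only [smul_mul_assoc, mul_smul_comm, r_acs]; module
  csas := by simp only [smul_mul_assoc, mul_smul_comm, r_csas]; module
  cas := by simp only [smul_mul_assoc, mul_smul_comm, r_cas]; module
  ccs := by simp only [smul_mul_assoc, mul_smul_comm, r_ccs]; module
  asa := by simp only [smul_mul_assoc, mul_smul_comm, smul_smul, h, one_smul, r_asa]
  aas := by
    have h' : w * z = 1 := by rw [mul_comm, h]
    simp only [smul_mul_assoc, mul_smul_comm, smul_smul, mul_assoc, h', one_smul, mul_one, r_aas]

theorem circle_mul_conj (u : Circle) : (u : ℂ) * conj (u : ℂ) = 1 := by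
  rw [Complex.mul_conj]; simp

/-- The `U(1)`-action `α_u : a ↦ u a, c ↦ u c, a^* ↦ u^* a^*, c^* ↦ u^* c^*`. -/
noncomputable def alpha (q : Set.Ioo (0 : ℝ) 1) (u : Circle) : ASU q →ₐ[ℂ] ASU q :=
  lift _ (isRep_scale (circle_mul_conj u))

theorem alpha_star (u : Circle) (x : ASU q) : alpha q u (star x) = star (alpha q u x) := by
  have h : starConj (alpha q u) (fun x => star (alpha q u (star x))) (fun _ => rfl)
      = alpha q u := by
    apply hom_ext
    intro g
    change star (alpha q u (star (gen q g))) = alpha q u (gen q g)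
    rw [star_gen]
    cases g <;> simp [alpha, Gen.adj, star_smul, star_gen]
  have := DFunLike.congr_fun h x
  rw [← star_star (alpha q u (star x))]
  exact congrArg star this

end ASU

open ASU

/-- The coordinate algebra of the quantum projective line: the `U(1)`-invariant elements. -/
noncomputable def CP (q : Set.Ioo (0 : ℝ) 1) : StarSubalgebra ℂ (ASU q) where
  carrier := {x | ∀ u : Circle, alpha q u x = x}
  mul_mem' hx hy u := by rw [map_mul, hx u, hy u]
  add_mem' hx hy u := by rw [map_add, hx u, hy u]
  algebraMap_mem' z u := (alpha q u).commutes z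
  star_mem' hx u := by rw [alpha_star, hx u]

/-- The line bundle `L_n = {x : K ▷ x = q^{n/2} x}`. -/
noncomputable def lineBundle (q : Set.Ioo (0 : ℝ) 1) (n : ℤ) : Submodule ℂ (ASU q) :=
  Module.End.eigenspace (actK q).toLinearMap (sq q ^ n)

/-! ## The three-dimensional calculus on quantum `SU(2)`

The left-invariant one-forms are indexed by `0 ↔ ω₋`, `1 ↔ ω₊`, `2 ↔ ω_z`; for a set
`S = {s₁ < ⋯ < s_k}` of indices let `ω_S = ω_{s₁} ∧ ⋯ ∧ ω_{s_k}`. -/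

/-- The algebra of forms: the free left `A(SU_q(2))`-module on the `ω_S`. The coordinate at `S` of a
form is the coefficient of `ω_S`. -/
def Forms (q : Set.Ioo (0 : ℝ) 1) : Type := Finset (Fin 3) → ASU q

namespace Forms

variable {q : Set.Ioo (0 : ℝ) 1}

noncomputable instance : AddCommGroup (Forms q) :=
  inferInstanceAs (AddCommGroup (Finset (Fin 3) → ASU q))
noncomputable instance : Module ℂ (Forms q) :=
  inferInstanceAs (Module ℂ (Finset (Fin 3) → ASU q))

/-- The coefficient of `ω_S`. -/
def coef (S : Finset (Fin 3)) : Forms q →ₗ[ℂ] ASU q :=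
  LinearMap.proj (R := ℂ) (φ := fun _ : Finset (Fin 3) => ASU q) S

/-- `f ↦ f ω_S`. -/
def single (S : Finset (Fin 3)) : ASU q →ₗ[ℂ] Forms q :=
  LinearMap.single ℂ (fun _ : Finset (Fin 3) => ASU q) S

theorem coef_single_same (S : Finset (Fin 3)) (f : ASU q) : coef S (single S f) = f :=
  Pi.single_eq_same (M := fun _ : Finset (Fin 3) => ASU q) S f

theorem coef_single_ne {S T : Finset (Fin 3)} (h : T ≠ S) (f : ASU q) :
    coef T (single S f) = 0 :=
  Pi.single_eq_of_ne (M := fun _ : Finset (Fin 3) => ASU q) h f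

theorem ext_coef {x y : Forms q} (h : ∀ S, coef S x = coef S y) : x = y := funext h

theorem sum_single (x : Forms q) : ∑ S, single S (coef S x) = x :=
  Finset.univ_sum_single (M := fun _ : Finset (Fin 3) => ASU q) x

theorem induction {p : Forms q → Prop} (h : ∀ S f, p (single S f))
    (hadd : ∀ x y, p x → p y → p (x + y)) (x : Forms q) : p x := by
  rw [← sum_single x]
  refine Finset.sum_induction _ p hadd ?_ (fun S _ => h S _)
  simpa using h ∅ 0

/-- For `t < s`, the scalar in `ω_s ∧ ω_t = swap s t ω_t ∧ ω_s`: the commutation relations are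
`ω₊ ∧ ω₋ = -q² ω₋ ∧ ω₊`, `ω_z ∧ ω₋ = -q⁴ ω₋ ∧ ω_z`, `ω_z ∧ ω₊ = -q⁻⁴ ω₊ ∧ ω_z`. -/
noncomputable def swap (q : Set.Ioo (0 : ℝ) 1) (s t : Fin 3) : ℂ :=
  if s = 1 ∧ t = 0 then -(Q q) ^ 2
  else if s = 2 ∧ t = 0 then -(Q q) ^ 4
  else if s = 2 ∧ t = 1 then -(Q q)⁻¹ ^ 4
  else 1

/-- For disjoint `S`, `T`, the scalar in `ω_S ∧ ω_T = wedgeCoef S T ω_{S ∪ T}`. -/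
noncomputable def wedgeCoef (q : Set.Ioo (0 : ℝ) 1) (S T : Finset (Fin 3)) : ℂ :=
  ∏ s ∈ S, ∏ t ∈ T, swap q s t

/-- Moving a function through a form: `ω_± f = (K² ▷ f) ω_±` and `ω_z f = (K⁴ ▷ f) ω_z`; the
exponent for `ω_S` is the sum of those of its factors. -/
def weight (S : Finset (Fin 3)) : ℕ := ∑ s ∈ S, if s = 2 then 4 else 2

/-- `ω_S f = (twist S f) ω_S`. -/
noncomputable def twist (q : Set.Ioo (0 : ℝ) 1) (S : Finset (Fin 3)) : ASU q →ₐ[ℂ] ASU q :=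
  actK q ^ weight S

/-- The product `(f ω_S) (g ω_T)`. -/
noncomputable def mulSingle (S T : Finset (Fin 3)) (f g : ASU q) : Forms q :=
  if Disjoint S T then single (S ∪ T) (wedgeCoef q S T • (f * twist q S g)) else 0

noncomputable instance : Mul (Forms q) :=
  ⟨fun x y => ∑ S, ∑ T, mulSingle S T (coef S x) (coef T y)⟩

noncomputable instance : One (Forms q) := ⟨single ∅ 1⟩

theorem mul_def (x y : Forms q) : x * y = ∑ S, ∑ T, mulSingle S T (coef S x) (coef T y) := rfl
theorem one_def : (1 : Forms q) = single ∅ 1 := rfl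

theorem mulSingle_add_left (S T : Finset (Fin 3)) (f f' g : ASU q) :
    mulSingle S T (f + f') g = mulSingle S T f g + mulSingle S T f' g := by
  unfold mulSingle; split_ifs <;> simp [add_mul]
theorem mulSingle_add_right (S T : Finset (Fin 3)) (f g g' : ASU q) :
    mulSingle S T f (g + g') = mulSingle S T f g + mulSingle S T f g' := by
  unfold mulSingle; split_ifs <;> simp [mul_add]
theorem mulSingle_smul_left (S T : Finset (Fin 3)) (z : ℂ) (f g : ASU q) :
    mulSingle S T (z • f) g = z • mulSingle S T f g := by
  unfold mulSingle; split_ifs <;> simp [smul_comm z]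
theorem mulSingle_smul_right (S T : Finset (Fin 3)) (z : ℂ) (f g : ASU q) :
    mulSingle S T f (z • g) = z • mulSingle S T f g := by
  unfold mulSingle; split_ifs <;> simp [smul_comm z]
theorem mulSingle_zero_left (S T : Finset (Fin 3)) (g : ASU q) :
    mulSingle S T 0 g = 0 := by simpa using mulSingle_smul_left S T 0 0 g
theorem mulSingle_zero_right (S T : Finset (Fin 3)) (f : ASU q) :
    mulSingle S T f 0 = 0 := by simpa using mulSingle_smul_right S T 0 f 0

theorem add_mul' (x y z : Forms q) : (x + y) * z = x * z + y * z := by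
  simp only [mul_def, map_add, mulSingle_add_left, Finset.sum_add_distrib]
theorem mul_add' (x y z : Forms q) : x * (y + z) = x * y + x * z := by
  simp only [mul_def, map_add, mulSingle_add_right, Finset.sum_add_distrib]
theorem smul_mul' (c : ℂ) (x y : Forms q) : (c • x) * y = c • (x * y) := by
  simp only [mul_def, map_smul, mulSingle_smul_left, Finset.smul_sum]
theorem mul_smul' (c : ℂ) (x y : Forms q) : x * (c • y) = c • (x * y) := by
  simp only [mul_def, map_smul, mulSingle_smul_right, Finset.smul_sum]
theorem zero_mul' (x : Forms q) : 0 * x = 0 := by simpa using smul_mul' 0 0 x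
theorem mul_zero' (x : Forms q) : x * 0 = 0 := by simpa using mul_smul' 0 x 0

theorem single_mul_single (S T : Finset (Fin 3)) (f g : ASU q) :
    single S f * single T g = mulSingle S T f g := by
  rw [mul_def, Finset.sum_eq_single S, Finset.sum_eq_single T]
  · rw [coef_single_same, coef_single_same]
  · intro U _ hU
    rw [coef_single_ne hU, mulSingle_zero_right]
  · simp
  · intro U _ hU
    simp only [coef_single_ne hU, mulSingle_zero_left, Finset.sum_const_zero]
  · simp

theorem mul_assoc_single (S T U : Finset (Fin 3)) (f g h : ASU q) :
    single S f * single T g * single U h = single S f * (single T g * single U h) := by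
  simp only [single_mul_single]
  by_cases hST : Disjoint S T
  · by_cases hTU : Disjoint T U
    · by_cases hSU : Disjoint S U
      · have h1 : Disjoint (S ∪ T) U := Finset.disjoint_union_left.2 ⟨hSU, hTU⟩
        have h2 : Disjoint S (T ∪ U) := Finset.disjoint_union_right.2 ⟨hST, hSU⟩
        rw [mulSingle, if_pos hST, single_mul_single, mulSingle, if_pos h1, mulSingle,
          if_pos hTU, single_mul_single, mulSingle, if_pos h2, Finset.union_assoc]
        congr 1
        have hw : twist q (S ∪ T) h = twist q S (twist q T h) := by
          simp only [twist, weight, Finset.sum_union hST, pow_add]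
          rfl
        have hc : wedgeCoef q (S ∪ T) U = wedgeCoef q S U * wedgeCoef q T U := by
          simp only [wedgeCoef, Finset.prod_union hST]
        have hc' : wedgeCoef q S (T ∪ U) = wedgeCoef q S T * wedgeCoef q S U := by
          simp only [wedgeCoef, Finset.prod_union hTU, Finset.prod_mul_distrib]
        rw [hw, hc, hc', map_smul, map_mul]
        simp only [smul_mul_assoc, mul_smul_comm, smul_smul, mul_assoc]
        congr 1
        ring
      · have h1 : ¬ Disjoint (S ∪ T) U := fun h => hSU (Finset.disjoint_union_left.1 h).1
        have h2 : ¬ Disjoint S (T ∪ U) := fun h => hSU (Finset.disjoint_union_right.1 h).2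
        rw [mulSingle, if_pos hST, single_mul_single, mulSingle, if_neg h1, mulSingle,
          if_pos hTU, single_mul_single, mulSingle, if_neg h2]
    · have h1 : ¬ Disjoint (S ∪ T) U := fun h => hTU (Finset.disjoint_union_left.1 h).2
      rw [mulSingle, if_pos hST, single_mul_single, mulSingle, if_neg h1, mulSingle,
          if_neg hTU, mul_zero']
  · rw [mulSingle, if_neg hST, zero_mul', mulSingle]
    split_ifs
    · have h2 : ¬ Disjoint S (T ∪ U) := fun h => hST (Finset.disjoint_union_right.1 h).1
      rw [single_mul_single, mulSingle, if_neg h2]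
    · rw [mul_zero']

theorem mul_assoc' (x y z : Forms q) : x * y * z = x * (y * z) := by
  induction x using Forms.induction with
  | hadd x x' h h' => simp only [add_mul', h, h']
  | h S f =>
    induction y using Forms.induction with
    | hadd y y' h h' => simp only [add_mul', mul_add', h, h']
    | h T g =>
      induction z using Forms.induction with
      | hadd z z' h h' => simp only [mul_add', h, h']
      | h U k => exact mul_assoc_single S T U f g k

theorem one_mul' (x : Forms q) : 1 * x = x := by
  induction x using Forms.induction with
  | hadd x x' h h' => simp only [mul_add', h, h']
  | h S f =>
    rw [one_def, single_mul_single, mulSingle, if_pos (Finset.disjoint_empty_left S)]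
    simp [wedgeCoef, twist, weight]

theorem mul_one' (x : Forms q) : x * 1 = x := by
  induction x using Forms.induction with
  | hadd x x' h h' => simp only [add_mul', h, h']
  | h S f =>
    rw [one_def, single_mul_single, mulSingle, if_pos (Finset.disjoint_empty_right S)]
    simp [wedgeCoef]

noncomputable instance : Ring (Forms q) :=
  { (inferInstance : AddCommGroup (Forms q)) with
    mul := (· * ·)
    one := 1
    left_distrib := mul_add'
    right_distrib := add_mul'
    zero_mul := zero_mul'
    mul_zero := mul_zero'
    mul_assoc := mul_assoc'
    one_mul := one_mul'
    mul_one := mul_one' }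

noncomputable instance : Algebra ℂ (Forms q) := Algebra.ofModule smul_mul' mul_smul'

/-- The inclusion of functions as forms of degree zero. -/
noncomputable def ofFun (q : Set.Ioo (0 : ℝ) 1) : ASU q →ₐ[ℂ] Forms q :=
  AlgHom.ofLinearMap (single ∅) rfl (by
    intro f g
    rw [single_mul_single, mulSingle, if_pos (Finset.disjoint_empty_left _)]
    simp [wedgeCoef, twist, weight])

/-- The left-invariant one-forms `ω₋`, `ω₊`, `ω_z`. -/
noncomputable def om (q : Set.Ioo (0 : ℝ) 1) (s : Fin 3) : Forms q := single {s} 1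

/-- The increasing list of the elements of `S`. -/
def toList (S : Finset (Fin 3)) : List (Fin 3) := [0, 1, 2].filter (· ∈ S)

/-- The product `ω_{s₁} ∧ ⋯ ∧ ω_{s_k}`. -/
noncomputable def omList (q : Set.Ioo (0 : ℝ) 1) (l : List (Fin 3)) : Forms q :=
  (l.map (om q)).prod

/-- The differentials of the left-invariant one-forms. -/
noncomputable def dOm (q : Set.Ioo (0 : ℝ) 1) (s : Fin 3) : Forms q :=
  if s = 0 then -((1 + (Q q)⁻¹ ^ 2) • (om q 2 * om q 0))
  else if s = 1 then ((Q q) ^ 2 * (1 + (Q q) ^ 2)) • (om q 2 * om q 1)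
  else -(om q 0 * om q 1)

/-- The differential of `ω_{s₁} ∧ ⋯ ∧ ω_{s_k}`, by the graded Leibniz rule. -/
noncomputable def dList (q : Set.Ioo (0 : ℝ) 1) : List (Fin 3) → Forms q
  | [] => 0
  | s :: l => dOm q s * omList q l - om q s * dList q l

/-- The vector fields `X₋`, `X₊`, `X_z` acting from the left. -/
noncomputable def X (q : Set.Ioo (0 : ℝ) 1) (s : Fin 3) : ASU q →ₗ[ℂ] ASU q :=
  if s = 0 then Xm q else if s = 1 then Xp q else Xz q

/-- The exterior differential: `d f = ∑ (X_s ▷ f) ω_s` on functions, and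
`d (f ω_S) = d f ∧ ω_S + f d ω_S`. -/
noncomputable def d (q : Set.Ioo (0 : ℝ) 1) : Forms q →ₗ[ℂ] Forms q :=
  ∑ S : Finset (Fin 3),
    ((∑ s : Fin 3, (LinearMap.mulRight ℂ (om q s * omList q (toList S))).comp
        ((ofFun q).toLinearMap.comp ((X q s).comp (coef S))))
      + (LinearMap.mulRight ℂ (dList q (toList S))).comp
        ((ofFun q).toLinearMap.comp (coef S)))

/-- The adjoints of the left-invariant one-forms: `ω₋^* = -ω₊`, `ω₊^* = -ω₋`, `ω_z^* = -ω_z`. -/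
noncomputable def starOm (q : Set.Ioo (0 : ℝ) 1) (s : Fin 3) : Forms q :=
  if s = 0 then -om q 1 else if s = 1 then -om q 0 else -om q 2

/-- The adjoint of `ω_{s₁} ∧ ⋯ ∧ ω_{s_k}`, by `(α ∧ β)^* = (-1)^{|α||β|} β^* ∧ α^*`. -/
noncomputable def starList (q : Set.Ioo (0 : ℝ) 1) : List (Fin 3) → Forms q
  | [] => 1
  | s :: l => (-1 : ℂ) ^ l.length • (starList q l * starOm q s)

/-- The involution on forms: `(f ω_S)^* = ω_S^* f^*`. -/
noncomputable def st (q : Set.Ioo (0 : ℝ) 1) : Forms q →ₗ⋆[ℂ] Forms q where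
  toFun x := ∑ S, starList q (toList S) * ofFun q (star (coef S x))
  map_add' x y := by
    simp only [map_add, star_add, mul_add, Finset.sum_add_distrib]
  map_smul' z x := by
    simp only [map_smul, star_smul, mul_smul_comm, Finset.smul_sum, starRingEnd_apply]

/-- The left coaction `Δ_L (f ω_S) = Δ(f) (1 ⊗ ω_S)`. -/
noncomputable def coaction (q : Set.Ioo (0 : ℝ) 1) : Forms q →ₗ[ℂ] ASU q ⊗[ℂ] Forms q :=
  ∑ S : Finset (Fin 3),
    ((single S).lTensor (ASU q)).comp ((comul q).toLinearMap.comp (coef S))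

/-- `∂ (f ω_S) = (X₊ ▷ f) ω₊ ∧ ω_S`. -/
noncomputable def del (q : Set.Ioo (0 : ℝ) 1) : Forms q →ₗ[ℂ] Forms q :=
  ∑ S : Finset (Fin 3), (LinearMap.mulRight ℂ (om q 1 * omList q (toList S))).comp
    ((ofFun q).toLinearMap.comp ((Xp q).comp (coef S)))

/-- `∂̄ (f ω_S) = (X₋ ▷ f) ω₋ ∧ ω_S`. -/
noncomputable def delbar (q : Set.Ioo (0 : ℝ) 1) : Forms q →ₗ[ℂ] Forms q :=
  ∑ S : Finset (Fin 3), (LinearMap.mulRight ℂ (om q 0 * omList q (toList S))).comp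
    ((ofFun q).toLinearMap.comp ((Xm q).comp (coef S)))

end Forms

/-! ## Differential `*`-calculi and complex structures

The graded algebra `Ω^•` is given as the internal direct sum of subspaces `Om n` of an ambient
algebra `R`; only the restriction of the maps on `R` to this sum matters. -/

section Abstract

variable {A R : Type*} [Ring A] [Algebra ℂ A] [StarRing A] [Ring R] [Algebra ℂ R]

/-- `Ω^• = ⨁ Om n` is a differential `*`-calculus over the `*`-algebra `A`, which is identified with
`Om 0` through `i`. -/
structure IsDifferentialStarCalculus (i : A →ₐ[ℂ] R) (Om : ℕ → Submodule ℂ R)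
    (d : R →ₗ[ℂ] R) (st : R →ₗ⋆[ℂ] R) : Prop where
  injective : Function.Injective i
  zero_eq : Om 0 = LinearMap.range i.toLinearMap
  independent : iSupIndep Om
  mul_mem : ∀ m n x y, x ∈ Om m → y ∈ Om n → x * y ∈ Om (m + n)
  d_mem : ∀ n x, x ∈ Om n → d x ∈ Om (n + 1)
  leibniz : ∀ m n x y, x ∈ Om m → y ∈ Om n →
    d (x * y) = d x * y + (-1 : ℂ) ^ m • (x * d y)
  d_d : ∀ n x, x ∈ Om n → d (d x) = 0
  star_of : ∀ a, st (i a) = i (star a)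
  star_mem : ∀ n x, x ∈ Om n → st x ∈ Om n
  star_star : ∀ n x, x ∈ Om n → st (st x) = x
  star_mul : ∀ m n x y, x ∈ Om m → y ∈ Om n →
    st (x * y) = (-1 : ℂ) ^ (m * n) • (st y * st x)
  d_star : ∀ n x, x ∈ Om n → d (st x) = st (d x)

/-- The bigraded algebra `⨁ Bi p r` with the differentials `del`, `delbar` is a complex structure
for the differential `*`-calculus `(⨁ Om n, d)`. -/
structure IsComplexStructure (Om : ℕ → Submodule ℂ R)
    (d : R →ₗ[ℂ] R) (st : R →ₗ⋆[ℂ] R) (Bi : ℕ → ℕ → Submodule ℂ R)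
    (del delbar : R →ₗ[ℂ] R) : Prop where
  one_mem : 1 ∈ Bi 0 0
  mul_mem : ∀ p r p' r' x y, x ∈ Bi p r → y ∈ Bi p' r' → x * y ∈ Bi (p + p') (r + r')
  independent : iSupIndep fun k : ℕ × ℕ => Bi k.1 k.2
  sum_eq : ∀ n, Om n = ⨆ k ∈ Finset.HasAntidiagonal.antidiagonal n, Bi k.1 k.2
  del_mem : ∀ p r x, x ∈ Bi p r → del x ∈ Bi (p + 1) r
  delbar_mem : ∀ p r x, x ∈ Bi p r → delbar x ∈ Bi p (r + 1)
  del_del : ∀ p r x, x ∈ Bi p r → del (del x) = 0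
  delbar_delbar : ∀ p r x, x ∈ Bi p r → delbar (delbar x) = 0
  del_leibniz : ∀ p r p' r' x y, x ∈ Bi p r → y ∈ Bi p' r' →
    del (x * y) = del x * y + (-1 : ℂ) ^ (p + r) • (x * del y)
  delbar_leibniz : ∀ p r p' r' x y, x ∈ Bi p r → y ∈ Bi p' r' →
    delbar (x * y) = delbar x * y + (-1 : ℂ) ^ (p + r) • (x * delbar y)
  d_eq : ∀ n x, x ∈ Om n → d x = del x + delbar x
  star_mem : ∀ p r x, x ∈ Bi p r → st x ∈ Bi r p
  star_del : ∀ p r x, x ∈ Bi p r → st (del x) = delbar (st x)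

end Abstract

/-! ## The calculus on the quantum projective line -/

section Projective

variable (q : Set.Ioo (0 : ℝ) 1)

/-- Functions on the projective line as forms of degree zero. -/
noncomputable def incl : CP q →ₐ[ℂ] Forms q := (Forms.ofFun q).comp (CP q).subtype.toAlgHom

/-- The restriction of the calculus on quantum `SU(2)` to the projective line:
`Ω^n` is spanned by the forms `f dg₁ ∧ ⋯ ∧ dg_n` with `f, g₁, …, g_n` functions on the
projective line. -/
noncomputable def OmegaCP (n : ℕ) : Submodule ℂ (Forms q) :=
  Submodule.span ℂ {x | ∃ (f : CP q) (g : Fin n → CP q),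
    x = incl q f * (List.ofFn fun k => Forms.d q (incl q (g k))).prod}

/-- `Ω^{(1,0)}`, the bimodule generated by the forms `∂ g`. -/
noncomputable def OmegaHol : Submodule ℂ (Forms q) :=
  Submodule.span ℂ {x | ∃ f g h : CP q, x = incl q f * Forms.del q (incl q g) * incl q h}

/-- `Ω^{(0,1)}`, the bimodule generated by the forms `∂̄ g`. -/
noncomputable def OmegaAnti : Submodule ℂ (Forms q) :=
  Submodule.span ℂ {x | ∃ f g h : CP q, x = incl q f * Forms.delbar q (incl q g) * incl q h}

/-- The forms of bidegree `(p, r)`: functions, `Ω^{(1,0)}`, `Ω^{(0,1)}`, and all two-forms in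
bidegree `(1,1)`. -/
noncomputable def OmegaBi : ℕ → ℕ → Submodule ℂ (Forms q)
  | 0, 0 => OmegaCP q 0
  | 1, 0 => OmegaHol q
  | 0, 1 => OmegaAnti q
  | 1, 1 => OmegaCP q 2
  | _, _ => ⊥

/-- The space `L ω = {f ω : f ∈ L}`. -/
noncomputable def timesForm (L : Submodule ℂ (ASU q)) (w : Forms q) : Submodule ℂ (Forms q) :=
  L.map ((LinearMap.mulRight ℂ w).comp (Forms.ofFun q).toLinearMap)

/-- Left covariance of the calculus `Ω^• (CP)`: the left coaction of `A(SU_q(2))` restricts to it,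
extends the coproduct, is multiplicative, and commutes with the differential. -/
structure IsLeftCovariant : Prop where
  coact_mem : ∀ n x, x ∈ OmegaCP q n →
    Forms.coaction q x ∈ LinearMap.range ((OmegaCP q n).subtype.lTensor (ASU q))
  coact_fun : ∀ f : CP q, Forms.coaction q (incl q f)
    = (Forms.ofFun q).toLinearMap.lTensor (ASU q) (ASU.comul q f)
  coact_mul : ∀ m n x y, x ∈ OmegaCP q m → y ∈ OmegaCP q n →
    Forms.coaction q (x * y) = Forms.coaction q x * Forms.coaction q y
  coact_d : ∀ n x, x ∈ OmegaCP q n →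
    Forms.coaction q (Forms.d q x) = (Forms.d q).lTensor (ASU q) (Forms.coaction q x)

end Projective

end QuantumProjectiveLine

open QuantumProjectiveLine

namespace QuantumProjectiveLine

namespace ASU

variable {q : Set.Ioo (0 : ℝ) 1}

/-! ### Induction over the generators -/

theorem induction {p : ASU q → Prop} (scalar : ∀ z : ℂ, p (algebraMap ℂ (ASU q) z))
    (gens : ∀ g, p (gen q g)) (add : ∀ x y, p x → p y → p (x + y))
    (mul : ∀ x y, p x → p y → p (x * y)) (x : ASU q) : p x := by
  obtain ⟨w, rfl⟩ := RingQuot.mkAlgHom_surjective ℂ (Rel q) x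
  change p (proj q w)
  induction w using FreeAlgebra.induction with
  | grade0 z => rw [AlgHom.commutes]; exact scalar z
  | grade1 g => exact gens g
  | mul x y hx hy => rw [map_mul]; exact mul _ _ hx hy
  | add x y hx hy => rw [map_add]; exact add _ _ hx hy

/-- A linear map satisfying a twisted Leibniz rule is determined by its values on generators. -/
theorem twisted_ext {B : Type*} [Ring B] [Algebra ℂ B] {D D' : ASU q →ₗ[ℂ] B}
    (σ τ : ASU q → B) (h1 : D 1 = D' 1)
    (hD : ∀ x y, D (x * y) = σ x * D y + D x * τ y)
    (hD' : ∀ x y, D' (x * y) = σ x * D' y + D' x * τ y)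
    (hg : ∀ g, D (gen q g) = D' (gen q g)) (x : ASU q) : D x = D' x := by
  induction x using ASU.induction with
  | scalar z => rw [Algebra.algebraMap_eq_smul_one, map_smul, map_smul, h1]
  | gens g => exact hg g
  | add x y hx hy => rw [map_add, map_add, hx, hy]
  | mul x y hx hy => rw [hD, hD', hx, hy]

/-! ### The left action as evaluation of the second leg of the coproduct -/

/-- Evaluation of the second leg, `x ⊗ y ↦ h(y) x`. -/
noncomputable def evalRight (h : ASU q →ₗ[ℂ] ℂ) : ASU q ⊗[ℂ] ASU q →ₗ[ℂ] ASU q :=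
  (TensorProduct.rid ℂ (ASU q)).toLinearMap.comp (h.lTensor (ASU q))

@[simp] theorem evalRight_tmul (h : ASU q →ₗ[ℂ] ℂ) (x y : ASU q) :
    evalRight h (x ⊗ₜ y) = h y • x := by
  simp [evalRight]

theorem act_eq (h : ASU q →ₗ[ℂ] ℂ) (x : ASU q) : act h x = evalRight h (comul q x) := rfl

/-- This turns a coproduct formula `Δh = k ⊗ h + h ⊗ l` for a functional into a twisted Leibniz rule
for its action, once applied to `Δ(x)Δ(y) = Δ(xy)`. General tensors are allowed because a coproduct
is not a pure tensor. -/
theorem evalRight_mul {h k l : ASU q →ₗ[ℂ] ℂ} (hh : ∀ x y, h (x * y) = k x * h y + h x * l y)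
    (t u : ASU q ⊗[ℂ] ASU q) :
    evalRight h (t * u) = evalRight k t * evalRight h u + evalRight h t * evalRight l u := by
  induction t using TensorProduct.induction_on with
  | zero => simp
  | add t t' ht ht' => simp only [add_mul, map_add, ht, ht']; abel
  | tmul x y =>
    induction u using TensorProduct.induction_on with
    | zero => simp
    | add u u' hu hu' => simp only [mul_add, map_add, hu, hu']; abel
    | tmul x' y' =>
      simp only [Algebra.TensorProduct.tmul_mul_tmul, evalRight_tmul, hh, smul_mul_assoc,
        mul_smul_comm, smul_smul, add_smul]
      congr 2 <;> ring

theorem actK_eq (x : ASU q) : actK q x = evalRight (pairK q).toLinearMap (comul q x) := by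
  change Algebra.TensorProduct.rid ℂ ℂ (ASU q)
    (Algebra.TensorProduct.map (AlgHom.id ℂ (ASU q)) (pairK q) (comul q x)) = _
  generalize comul q x = t
  induction t using TensorProduct.induction_on with
  | zero => simp
  | add t t' ht ht' => simp only [map_add, ht, ht']
  | tmul x y => simp

/-- The character `⟨K⁻¹, ·⟩`. -/
noncomputable def pairKInv (q : Set.Ioo (0 : ℝ) 1) : ASU q →ₐ[ℂ] ℂ :=
  lift (fun g => match g with
    | .a => sq q
    | .as => (sq q)⁻¹
    | .c => 0
    | .cs => 0) (by
    have := sq_ne q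
    constructor <;> simp [this])

/-- The operator `K⁻¹ ▷`. -/
noncomputable def actKInv (q : Set.Ioo (0 : ℝ) 1) : ASU q →ₐ[ℂ] ASU q :=
  ((Algebra.TensorProduct.rid ℂ ℂ (ASU q)).toAlgHom.comp
    (Algebra.TensorProduct.map (AlgHom.id ℂ (ASU q)) (pairKInv q))).comp (comul q)

theorem actKInv_eq (x : ASU q) :
    actKInv q x = evalRight (pairKInv q).toLinearMap (comul q x) := by
  change Algebra.TensorProduct.rid ℂ ℂ (ASU q)
    (Algebra.TensorProduct.map (AlgHom.id ℂ (ASU q)) (pairKInv q) (comul q x)) = _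
  generalize comul q x = t
  induction t using TensorProduct.induction_on with
  | zero => simp
  | add t t' ht ht' => simp only [map_add, ht, ht']
  | tmul x y => simp

/-- The degree of a generator, `1` for `a, c` and `-1` for `a^*, c^*`. -/
def Gen.deg : Gen → ℤ
  | .a => 1 | .c => 1 | .as => -1 | .cs => -1

theorem actK_gen (g : Gen) : actK q (gen q g) = (sq q ^ (-Gen.deg g)) • gen q g := by
  cases g <;> simp [actK_eq, comul, comulGen, pairK, Gen.deg]

theorem actKInv_gen (g : Gen) : actKInv q (gen q g) = (sq q ^ Gen.deg g) • gen q g := by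
  cases g <;> simp [actKInv_eq, comul, comulGen, pairKInv, Gen.deg]

theorem actKInv_actK (x : ASU q) : actKInv q (actK q x) = x := by
  have h : (actKInv q).comp (actK q) = AlgHom.id ℂ (ASU q) := by
    apply hom_ext
    intro g
    change actKInv q (actK q (gen q g)) = gen q g
    rw [actK_gen, map_smul, actKInv_gen, smul_smul, ← zpow_add₀ (sq_ne q)]
    simp
  exact DFunLike.congr_fun h x

/-! ### Twisted Leibniz rules for `E`, `F`, `X₊`, `X₋` -/

theorem pairRep_entries (u v : ℂ) (x : ASU q) :
    pairRep q u v x 0 0 = pairKInv q x ∧ pairRep q u v x 1 0 = 0 ∧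
      pairRep q u v x 1 1 = pairK q x := by
  induction x using ASU.induction with
  | scalar z => simp [Matrix.algebraMap_matrix_apply]
  | gens g => cases g <;> simp [pairRep, pairKInv, pairK]
  | add x y hx hy => simp [hx, hy]
  | mul x y hx hy => simp [Matrix.mul_apply, Fin.sum_univ_two, hx, hy]

/-- The corner entry of a product of upper triangular matrices, whose diagonal entries are the
characters of `K⁻¹` and `K`. It encodes the coproducts of `E` and `F`. -/
theorem pairRep_mul (u v : ℂ) (x y : ASU q) :
    pairRep q u v (x * y) 0 1
      = pairKInv q x * pairRep q u v y 0 1 + pairRep q u v x 0 1 * pairK q y := by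
  simp [Matrix.mul_apply, Fin.sum_univ_two, pairRep_entries]

theorem actE_mul (x y : ASU q) :
    actE q (x * y) = actKInv q x * actE q y + actE q x * actK q y := by
  rw [actKInv_eq, actK_eq, actE, act_eq, act_eq, act_eq, map_mul]
  exact evalRight_mul (pairRep_mul 1 0) _ _

theorem actF_mul (x y : ASU q) :
    actF q (x * y) = actKInv q x * actF q y + actF q x * actK q y := by
  rw [actKInv_eq, actK_eq, actF, act_eq, act_eq, act_eq, map_mul]
  exact evalRight_mul (pairRep_mul 0 _) _ _

/-- Precomposing `E` with `K` cancels the `K⁻¹` on the left factor and doubles the `K` on the right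
factor. The remaining twist `K²` is the one in `ω₊ f = (K² ▷ f) ω₊`. -/
theorem Xp_mul (x y : ASU q) :
    Xp q (x * y) = x * Xp q y + Xp q x * (actK q ^ 2) y := by
  simp only [Xp, LinearMap.smul_apply, LinearMap.comp_apply, AlgHom.toLinearMap_apply, map_mul,
    actE_mul, actKInv_actK, smul_add, mul_smul_comm, smul_mul_assoc]
  rfl

theorem Xm_mul (x y : ASU q) :
    Xm q (x * y) = x * Xm q y + Xm q x * (actK q ^ 2) y := by
  simp only [Xm, LinearMap.smul_apply, LinearMap.comp_apply, AlgHom.toLinearMap_apply, map_mul,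
    actF_mul, actKInv_actK, smul_add, mul_smul_comm, smul_mul_assoc]
  rfl

theorem Xp_one : Xp q 1 = 0 := by
  have h := Xp_mul (q := q) 1 1
  simpa using h

theorem Xm_one : Xm q 1 = 0 := by
  have h := Xm_mul (q := q) 1 1
  simpa using h

theorem Xp_a : Xp q (gen q .a) = -(Q q • gen q .cs) := by
  have h := sq_ne q
  simp [Xp, actK_gen, actE, act_eq, comul, comulGen, pairE, pairRep, Gen.deg, smul_smul, h]
theorem Xp_c : Xp q (gen q .c) = gen q .as := by
  have h := sq_ne q
  simp [Xp, actK_gen, actE, act_eq, comul, comulGen, pairE, pairRep, Gen.deg, smul_smul, h]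
theorem Xp_as : Xp q (gen q .as) = 0 := by
  simp [Xp, actK_gen, actE, act_eq, comul, comulGen, pairE, pairRep, Gen.deg]
theorem Xp_cs : Xp q (gen q .cs) = 0 := by
  simp [Xp, actK_gen, actE, act_eq, comul, comulGen, pairE, pairRep, Gen.deg]

theorem Xm_a : Xm q (gen q .a) = 0 := by
  simp [Xm, actK_gen, actF, act_eq, comul, comulGen, pairF, pairRep, Gen.deg]
theorem Xm_c : Xm q (gen q .c) = 0 := by
  simp [Xm, actK_gen, actF, act_eq, comul, comulGen, pairF, pairRep, Gen.deg]
theorem Xm_as : Xm q (gen q .as) = gen q .c := by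
  have h := sq_ne q
  have h' := Q_ne q
  simp [Xm, actK_gen, actF, act_eq, comul, comulGen, pairF, pairRep, Gen.deg, smul_smul, h, h']
theorem Xm_cs : Xm q (gen q .cs) = -((Q q)⁻¹ • gen q .a) := by
  have h := sq_ne q
  simp [Xm, actK_gen, actF, act_eq, comul, comulGen, pairF, pairRep, Gen.deg, smul_smul, h]

/-! ### Commutation relations of `K`, `X₊`, `X₋`, `X_z` and the involution -/

theorem actK_a : actK q (gen q .a) = (sq q)⁻¹ • gen q .a := by simp [actK_gen, Gen.deg]
theorem actK_c : actK q (gen q .c) = (sq q)⁻¹ • gen q .c := by simp [actK_gen, Gen.deg]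
theorem actK_as : actK q (gen q .as) = sq q • gen q .as := by simp [actK_gen, Gen.deg]
theorem actK_cs : actK q (gen q .cs) = sq q • gen q .cs := by simp [actK_gen, Gen.deg]

theorem actK_sq_apply (x : ASU q) : (actK q ^ 2) x = actK q (actK q x) := rfl

/-- Both sides satisfy the same Leibniz rule, twisted by `K` on the left and by `K³` on the right,
so the generators decide. -/
theorem actK_Xp (x : ASU q) : actK q (Xp q x) = Q q • Xp q (actK q x) := by
  have h := sq_ne q
  refine twisted_ext (D := (actK q).toLinearMap.comp (Xp q))
    (D' := Q q • (Xp q).comp (actK q).toLinearMap) (actK q) (fun y => (actK q ^ 2) (actK q y))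
    ?_ ?_ ?_ ?_ x
  · simp [Xp_one]
  · intro x y
    simp [Xp_mul, actK_sq_apply]
  · intro x y
    simp [Xp_mul, actK_sq_apply]
  · intro g
    cases g <;> simp [Xp_a, Xp_c, Xp_as, Xp_cs, actK_a, actK_c, actK_as, actK_cs, smul_smul,
      ← sq_mul, h]

theorem actK_Xm (x : ASU q) : actK q (Xm q x) = (Q q)⁻¹ • Xm q (actK q x) := by
  have h := sq_ne q
  refine twisted_ext (D := (actK q).toLinearMap.comp (Xm q))
    (D' := (Q q)⁻¹ • (Xm q).comp (actK q).toLinearMap) (actK q)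
    (fun y => (actK q ^ 2) (actK q y)) ?_ ?_ ?_ ?_ x
  · simp [Xm_one]
  · intro x y
    simp [Xm_mul, actK_sq_apply]
  · intro x y
    simp [Xm_mul, actK_sq_apply]
  · intro g
    cases g <;> simp [Xm_a, Xm_c, Xm_as, Xm_cs, actK_a, actK_c, actK_as, actK_cs, smul_smul,
      ← sq_mul, h]

theorem Q_sq_ne_one : Q q ^ 2 ≠ 1 := by
  have h1 := q.2.1
  have h2 := q.2.2
  have h : (q : ℝ) ^ 2 ≠ 1 := by nlinarith
  intro h'
  apply h
  rw [Q] at h'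
  exact_mod_cast h'

theorem one_sub_inv_ne : 1 - (Q q)⁻¹ ^ 2 ≠ 0 := by
  intro h
  apply Q_sq_ne_one (q := q)
  rw [inv_pow, sub_eq_zero, eq_comm, inv_eq_one] at h
  exact h

theorem Xz_mul (x y : ASU q) : Xz q (x * y) = x * Xz q y + Xz q x * (actK q ^ 4) y := by
  simp only [Xz, LinearMap.smul_apply, LinearMap.sub_apply, LinearMap.id_apply,
    AlgHom.toLinearMap_apply, map_mul, smul_mul_assoc, mul_smul_comm, ← smul_add]
  congr 1
  noncomm_ring

theorem Xz_of_actK {x : ASU q} {z : ℂ} (h : actK q x = z • x) :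
    Xz q x = ((1 - z ^ 4) / (1 - (Q q)⁻¹ ^ 2)) • x := by
  have h4 : (actK q ^ 4) x = z ^ 4 • x := by
    change actK q (actK q (actK q (actK q x))) = _
    simp only [h, map_smul, smul_smul]
    congr 1; ring
  simp only [Xz, LinearMap.smul_apply, LinearMap.sub_apply, LinearMap.id_apply,
    AlgHom.toLinearMap_apply, h4]
  rw [div_eq_inv_mul, mul_smul, sub_smul, one_smul]

/-- This commutator relation is what makes `∂` and `∂̄` anticommute on functions of degree 0. Like
`X_z`, the left side is a derivation twisted by `K⁴` on the right, so generators suffice. -/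
theorem Xm_Xp_comm (x : ASU q) :
    Xm q (Xp q x) - Q q ^ 2 • Xp q (Xm q x) = Xz q x := by
  have hQ := Q_ne q
  have h := sq_ne q
  have h1 : Xz q (1 : ASU q) = 0 := by simpa using Xz_mul (q := q) 1 1
  have hs4 : (sq q) ^ 4 = Q q ^ 2 := by rw [← sq_mul]; ring
  refine twisted_ext (D := (Xm q).comp (Xp q) - Q q ^ 2 • (Xp q).comp (Xm q)) (D' := Xz q)
    id (fun y => (actK q ^ 4) y) ?_ ?_ Xz_mul ?_ x
  · simp [Xm_one, Xp_one, h1]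
  · intro x y
    change Xm q (Xp q (x * y)) - Q q ^ 2 • Xp q (Xm q (x * y))
      = x * (Xm q (Xp q y) - Q q ^ 2 • Xp q (Xm q y))
        + (Xm q (Xp q x) - Q q ^ 2 • Xp q (Xm q x)) * actK q (actK q (actK q (actK q y)))
    simp only [Xm_mul, Xp_mul, map_add, actK_sq_apply, actK_Xp, actK_Xm, map_smul, smul_smul,
      mul_add, add_mul, mul_sub, sub_mul, smul_add, mul_smul_comm, smul_mul_assoc]
    -- The mixed terms `(X₋x)(X₊K²y)` and `(X₊x)(X₋K²y)` cancel, since moving `K²` past `X₊` gives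
    -- `q²` and past `X₋` gives `q⁻²`.
    match_scalars <;> field_simp <;> ring
  · have hne := one_sub_inv_ne (q := q)
    have h2 : Q q ^ 2 - 1 ≠ 0 := sub_ne_zero.2 Q_sq_ne_one
    intro g
    cases g
    · rw [Xz_of_actK actK_a, inv_pow, hs4, ← inv_pow, div_self hne]
      simp [Xm_a, Xp_a, Xm_cs, hQ]
    · rw [Xz_of_actK actK_as, hs4]
      simp only [LinearMap.sub_apply, LinearMap.comp_apply, LinearMap.smul_apply, Xp_as, Xm_as,
        Xp_c, map_zero, zero_sub]
      rw [← neg_smul]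
      congr 1
      field_simp
      ring
    · rw [Xz_of_actK actK_c, inv_pow, hs4, ← inv_pow, div_self hne]
      simp [Xm_c, Xp_c, Xm_as, hQ]
    · rw [Xz_of_actK actK_cs, hs4]
      simp only [LinearMap.sub_apply, LinearMap.comp_apply, LinearMap.smul_apply, Xp_cs, Xm_cs,
        Xp_a, map_zero, zero_sub, map_neg, map_smul, smul_neg, neg_neg, smul_smul]
      rw [← neg_smul]
      congr 1
      field_simp
      ring

theorem conj_sq : conj (sq q) = sq q := Complex.conj_ofReal _

/-- The involution exchanges `K` and `K⁻¹`; stating this with `K` on both sides avoids the inverse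
operator. -/
theorem star_actK (x : ASU q) : actK q (star (actK q x)) = star x := by
  induction x using ASU.induction with
  | scalar z => simp [Algebra.algebraMap_eq_smul_one, star_smul]
  | gens g =>
    have h := sq_ne q
    cases g <;> simp [actK_gen, star_smul, star_gen, Gen.adj, Gen.deg, conj_sq, smul_smul, h]
  | add x y hx hy => simp [hx, hy]
  | mul x y hx hy => simp [hx, hy]

/-- The compatibility of `X₋`, `X₊` with the involution. -/
theorem Xm_star (x : ASU q) : Xm q (star x) = -((actK q ^ 2) (star (Xp q x))) := by
  simp only [actK_sq_apply]
  induction x using ASU.induction with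
  | scalar z => simp [Algebra.algebraMap_eq_smul_one, star_smul, Xm_one, Xp_one]
  | gens g =>
    have h := sq_ne q
    have hQ := Q_ne q
    have hc : star (Q q) = Q q := conj_Q q
    cases g <;> simp [star_gen, Gen.adj, Xm_a, Xm_c, Xm_as, Xm_cs, Xp_a, Xp_c, Xp_as, Xp_cs,
      actK_a, actK_c, star_smul, hc, smul_smul, ← mul_inv, sq_mul, hQ, mul_assoc]
  | add x y hx hy => simp [hx, hy]; abel
  | mul x y hx hy =>
    simp only [star_mul, Xm_mul, Xp_mul, star_add, map_add, map_mul, hx, hy, actK_sq_apply,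
      star_actK, neg_add, mul_neg, neg_mul]
    abel

/-! ### The grading -/

/-- The span of the monomials of degree `n`, where `a, c` have degree `1` and `a^*, c^*` have
degree `-1`. -/
def homog (q : Set.Ioo (0 : ℝ) 1) (n : ℤ) : Submodule ℂ (ASU q) :=
  Submodule.span ℂ {x | ∃ l : List Gen, (l.map Gen.deg).sum = n ∧ x = (l.map (gen q)).prod}

/-- The property ranges over all degrees at once because the induction strips one generator from the
left of a monomial, which changes the degree. -/
theorem homog_induction {p : ℤ → ASU q → Prop} (hzero : ∀ n, p n 0)
    (hadd : ∀ n x y, p n x → p n y → p n (x + y)) (hsmul : ∀ n (z : ℂ) x, p n x → p n (z • x))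
    (hone : p 0 1) (hmul : ∀ n g x, p n x → p (Gen.deg g + n) (gen q g * x))
    {n : ℤ} {x : ASU q} (hx : x ∈ homog q n) : p n x := by
  refine Submodule.span_induction ?_ (hzero n) (fun x y _ _ => hadd n x y)
    (fun z x _ => hsmul n z x) hx
  rintro _ ⟨l, rfl, rfl⟩
  clear hx
  induction l with
  | nil => simpa using hone
  | cons g l ih => simpa using hmul _ g _ ih

theorem one_mem_homog : (1 : ASU q) ∈ homog q 0 :=
  Submodule.subset_span ⟨[], by simp, by simp⟩

theorem gen_mem_homog (g : Gen) : gen q g ∈ homog q (Gen.deg g) :=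
  Submodule.subset_span ⟨[g], by simp, by simp⟩

theorem mul_mem_homog {m n : ℤ} {x y : ASU q} (hx : x ∈ homog q m) (hy : y ∈ homog q n) :
    x * y ∈ homog q (m + n) := by
  have h : x * y ∈ homog q m * homog q n := Submodule.mul_mem_mul hx hy
  rw [homog, homog, Submodule.span_mul_span] at h
  refine Submodule.span_le.2 ?_ h
  rintro _ ⟨_, ⟨l, rfl, rfl⟩, _, ⟨l', rfl, rfl⟩, rfl⟩
  exact Submodule.subset_span ⟨l ++ l', by simp, by simp⟩

/-- The sum of the pieces is closed under products and contains the scalars and the generators.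
Independence of the pieces is not needed here: it comes from the eigenvalues. -/
theorem iSup_homog : ⨆ n, homog q n = ⊤ := by
  refine eq_top_iff.2 fun x _ => ?_
  have key : ∀ x ∈ ⨆ n, homog q n, ∀ y ∈ ⨆ n, homog q n, x * y ∈ ⨆ n, homog q n := by
    intro x hx y hy
    induction hx using Submodule.iSup_induction' with
    | zero => simp
    | add x x' _ _ h h' => rw [add_mul]; exact add_mem h h'
    | mem m x hx =>
      induction hy using Submodule.iSup_induction' with
      | zero => simp
      | add y y' _ _ h h' => rw [mul_add]; exact add_mem h h'
      | mem n y hy => exact Submodule.mem_iSup_of_mem (m + n) (mul_mem_homog hx hy)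
  induction x using ASU.induction with
  | scalar z =>
    rw [Algebra.algebraMap_eq_smul_one]
    exact Submodule.smul_mem _ _ (Submodule.mem_iSup_of_mem 0 one_mem_homog)
  | gens g => exact Submodule.mem_iSup_of_mem _ (gen_mem_homog g)
  | add x y hx hy => exact add_mem (hx trivial) (hy trivial)
  | mul x y hx hy => exact key x (hx trivial) y (hy trivial)

/-- A family of subspaces of eigenspaces for distinct eigenvalues that spans everything consists of
the full eigenspaces. -/
theorem eigenspace_eq_of_iSup_eq_top {V : Type*} [AddCommGroup V] [Module ℂ V]
    (f : Module.End ℂ V) {ι : Type*} (μ : ι → ℂ) (hμ : Function.Injective μ)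
    (M : ι → Submodule ℂ V) (hM : ∀ i, M i ≤ f.eigenspace (μ i)) (htop : ⨆ i, M i = ⊤) (i : ι) :
    f.eigenspace (μ i) = M i := by
  refine le_antisymm (fun x hx => ?_) (hM i)
  have hind := (Module.End.eigenspaces_iSupIndep f).comp hμ
  have hx' : x ∈ M i ⊔ ⨆ j ≠ i, M j := by
    have : (⨆ j, M j) ≤ M i ⊔ ⨆ j ≠ i, M j := by
      refine iSup_le fun j => ?_
      by_cases h : j = i
      · rw [h]; exact le_sup_left
      · exact le_sup_of_le_right (le_iSup₂_of_le j h le_rfl)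
    exact this (htop ▸ Submodule.mem_top)
  obtain ⟨y, hy, z, hz, rfl⟩ := Submodule.mem_sup.1 hx'
  have hz1 : z ∈ f.eigenspace (μ i) := by
    have := sub_mem hx (hM i hy)
    simpa using this
  have hz2 : z ∈ ⨆ j ≠ i, f.eigenspace (μ j) :=
    (iSup₂_mono fun j _ => hM j : (⨆ j ≠ i, M j) ≤ _) hz
  have : z = 0 := Submodule.disjoint_def.1 (hind i) z hz1 hz2
  rw [this, add_zero]
  exact hy

theorem actK_of_mem_homog {n : ℤ} {x : ASU q} (hx : x ∈ homog q n) :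
    actK q x = sq q ^ (-n) • x := by
  refine homog_induction (p := fun n x => actK q x = sq q ^ (-n) • x) (by simp)
    (fun n x y hx hy => by rw [map_add, hx, hy, smul_add])
    (fun n z x hx => by rw [map_smul, hx, smul_comm]) (by simp) (fun n g x hx => ?_) hx
  rw [map_mul, hx, actK_gen, smul_mul_smul_comm, ← zpow_add₀ (sq_ne q), neg_add]

theorem alpha_of_mem_homog (u : Circle) {n : ℤ} {x : ASU q} (hx : x ∈ homog q n) :
    alpha q u x = (u : ℂ) ^ n • x := by
  have hu : (u : ℂ) ≠ 0 := u.coe_ne_zero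
  refine homog_induction (p := fun n x => alpha q u x = (u : ℂ) ^ n • x) (by simp)
    (fun n x y hx hy => by rw [map_add, hx, hy, smul_add])
    (fun n z x hx => by rw [map_smul, hx, smul_comm]) (by simp) (fun n g x hx => ?_) hx
  have hg : alpha q u (gen q g) = (u : ℂ) ^ Gen.deg g • gen q g := by
    have h : conj (u : ℂ) = (u : ℂ)⁻¹ := (Circle.coe_inv_eq_conj u).symm
    cases g <;> simp [alpha, Gen.deg, h]
  rw [map_mul, hx, hg, smul_mul_smul_comm, ← zpow_add₀ hu]

/-! ### Line bundles and the projective line as graded pieces -/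

theorem zpow_injective_sq : Function.Injective fun n : ℤ => sq q ^ n := by
  intro m n h
  have h0 : 0 < Real.sqrt (q : ℝ) := Real.sqrt_pos.2 q.2.1
  have h1 : Real.sqrt (q : ℝ) ≠ 1 := by
    rw [Ne, Real.sqrt_eq_one]
    exact q.2.2.ne
  refine zpow_right_injective₀ h0 h1 ?_
  simp only [sq] at h ⊢
  exact_mod_cast h

/-- The sign reflects `K ▷ a = q^{-1/2} a`: the generators of degree 1 lie in the line bundle of
index -1. -/
theorem lineBundle_eq (n : ℤ) : lineBundle q n = homog q (-n) := by
  have h := eigenspace_eq_of_iSup_eq_top (actK q).toLinearMap (fun n : ℤ => sq q ^ (-n))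
    (zpow_injective_sq.comp neg_injective) (homog q)
    (fun n x hx => Module.End.mem_eigenspace_iff.2 (actK_of_mem_homog hx)) iSup_homog (-n)
  simpa [lineBundle] using h

theorem exists_circle_zpow_injective :
    ∃ u : Circle, Function.Injective fun n : ℤ => (u : ℂ) ^ n := by
  -- The point `e^i` is not a root of unity: equal powers with distinct exponents would make π
  -- rational.
  refine ⟨Circle.exp 1, fun m n h => ?_⟩
  simp only [Circle.coe_exp, ← Complex.exp_int_mul] at h
  obtain ⟨k, hk⟩ := Complex.exp_eq_exp_iff_exists_int.1 h
  have hk' : ((m : ℝ)) = n + k * (2 * Real.pi) := by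
    have h2 : ((m : ℂ)) * Complex.I = (n + k * (2 * Real.pi)) * Complex.I := by
      rw [Complex.ofReal_one, one_mul] at hk
      rw [hk]; ring
    have h3 := mul_right_cancel₀ Complex.I_ne_zero h2
    exact_mod_cast h3
  by_contra hne
  have hk0 : k ≠ 0 := by
    rintro rfl
    apply hne
    have : (m : ℝ) = n := by simpa using hk'
    exact_mod_cast this
  have hirr := irrational_pi
  apply hirr
  refine ⟨((m : ℚ) - n) / (2 * k), ?_⟩
  have hk1 : (k : ℝ) ≠ 0 := by exact_mod_cast hk0
  push_cast
  rw [hk']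
  field_simp
  ring

/-- Invariance under a single `u` of infinite order already forces degree 0, by the eigenspace
argument. -/
theorem mem_CP_iff {x : ASU q} : x ∈ CP q ↔ x ∈ homog q 0 := by
  constructor
  · intro hx
    obtain ⟨u, hu⟩ := exists_circle_zpow_injective
    have h := eigenspace_eq_of_iSup_eq_top (alpha q u).toLinearMap (fun n : ℤ => (u : ℂ) ^ n) hu
      (homog q) (fun n x hx => Module.End.mem_eigenspace_iff.2 (alpha_of_mem_homog u hx))
      iSup_homog 0
    rw [← h, Module.End.mem_eigenspace_iff]
    simpa using hx u
  · intro hx u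
    simpa using alpha_of_mem_homog u hx

/-- The degree is read off from the eigenvalue of `K`, which `X₊` multiplies by `q`. -/
theorem Xp_mem_homog {n : ℤ} {x : ASU q} (hx : x ∈ homog q n) : Xp q x ∈ homog q (n - 2) := by
  rw [← neg_neg (n - 2), ← lineBundle_eq, lineBundle, Module.End.mem_eigenspace_iff]
  rw [AlgHom.toLinearMap_apply, actK_Xp, actK_of_mem_homog hx, map_smul, smul_smul, ← sq_mul]
  congr 1
  rw [neg_sub, sub_eq_add_neg, zpow_add₀ (sq_ne q)]
  norm_cast
  ring

theorem Xm_mem_homog {n : ℤ} {x : ASU q} (hx : x ∈ homog q n) : Xm q x ∈ homog q (n + 2) := by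
  rw [← neg_neg (n + 2), ← lineBundle_eq, lineBundle, Module.End.mem_eigenspace_iff]
  rw [AlgHom.toLinearMap_apply, actK_Xm, actK_of_mem_homog hx, map_smul, smul_smul, ← sq_mul]
  congr 1
  rw [neg_add, zpow_add₀ (sq_ne q), zpow_neg _ 2, mul_inv]
  norm_cast
  ring

theorem star_mem_homog {n : ℤ} {x : ASU q} (hx : x ∈ homog q n) : star x ∈ homog q (-n) := by
  have h := star_actK x
  rw [actK_of_mem_homog hx, star_smul, map_smul, ← starRingEnd_apply, map_zpow₀, conj_sq] at h
  rw [← lineBundle_eq, lineBundle, Module.End.mem_eigenspace_iff]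
  have h' : actK q (star x) = sq q ^ n • (sq q ^ (-n) • actK q (star x)) := by
    rw [smul_smul, ← zpow_add₀ (sq_ne q), add_neg_cancel, zpow_zero, one_smul]
  rw [AlgHom.toLinearMap_apply, h', h]

/-- In the coproduct of a generator, every second leg has the degree of that generator. This is why
the left coaction preserves the coefficient spaces of the calculus. -/
theorem comul_mem_homog {n : ℤ} {x : ASU q} (hx : x ∈ homog q n) :
    comul q x ∈ LinearMap.range ((homog q n).subtype.lTensor (ASU q)) := by
  have tm : ∀ {n : ℤ} (x : ASU q) {y : ASU q}, y ∈ homog q n →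
      x ⊗ₜ[ℂ] y ∈ LinearMap.range ((homog q n).subtype.lTensor (ASU q)) :=
    fun {n} x {y} hy => ⟨x ⊗ₜ ⟨y, hy⟩, by simp⟩
  have hgen : ∀ g, comul q (gen q g)
      ∈ LinearMap.range ((homog q (Gen.deg g)).subtype.lTensor (ASU q)) := by
    intro g
    cases g <;> simp only [comul, lift_gen, comulGen]
    · exact sub_mem (tm _ (gen_mem_homog .a)) (Submodule.smul_mem _ _ (tm _ (gen_mem_homog .c)))
    · exact sub_mem (tm _ (gen_mem_homog .as)) (Submodule.smul_mem _ _ (tm _ (gen_mem_homog .cs)))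
    · exact add_mem (tm _ (gen_mem_homog .a)) (tm _ (gen_mem_homog .c))
    · exact add_mem (tm _ (gen_mem_homog .cs)) (tm _ (gen_mem_homog .as))
  have hmul : ∀ {m n : ℤ} (s t), s ∈ LinearMap.range ((homog q m).subtype.lTensor (ASU q)) →
      t ∈ LinearMap.range ((homog q n).subtype.lTensor (ASU q)) →
      s * t ∈ LinearMap.range ((homog q (m + n)).subtype.lTensor (ASU q)) := by
    rintro m n _ _ ⟨s, rfl⟩ ⟨t, rfl⟩
    induction s using TensorProduct.induction_on with
    | zero => simp
    | add s s' h h' => rw [map_add, add_mul]; exact add_mem h h'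
    | tmul x y =>
      induction t using TensorProduct.induction_on with
      | zero => simp
      | add t t' h h' => rw [map_add, mul_add]; exact add_mem h h'
      | tmul x' y' =>
        simp only [LinearMap.lTensor_tmul, Algebra.TensorProduct.tmul_mul_tmul]
        exact tm _ (mul_mem_homog y.2 y'.2)
  refine homog_induction (p := fun n x =>
      comul q x ∈ LinearMap.range ((homog q n).subtype.lTensor (ASU q))) (by simp)
    (fun n x y hx hy => by rw [map_add]; exact add_mem hx hy)
    (fun n z x hx => by rw [map_smul]; exact Submodule.smul_mem _ _ hx)
    (by rw [map_one]; exact tm 1 one_mem_homog)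
    (fun n g x hx => by rw [map_mul]; exact hmul _ _ (hgen g) hx) hx

end ASU

end QuantumProjectiveLine

namespace QuantumProjectiveLine

namespace Forms

open ASU

variable {q : Set.Ioo (0 : ℝ) 1}

/-! ### The structure maps on the forms `f ω_S` -/

theorem single_empty_mul (S : Finset (Fin 3)) (f g : ASU q) :
    single ∅ f * single S g = single S (f * g) := by
  rw [single_mul_single, mulSingle, if_pos (Finset.disjoint_empty_left S)]
  simp [wedgeCoef, twist, weight]

theorem single_mul_empty (S : Finset (Fin 3)) (f g : ASU q) :
    single S f * single ∅ g = single S (f * twist q S g) := by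
  rw [single_mul_single, mulSingle, if_pos (Finset.disjoint_empty_right S)]
  simp [wedgeCoef]

theorem single_mul_of_not_disjoint {S T : Finset (Fin 3)} (h : ¬ Disjoint S T) (f g : ASU q) :
    single S f * single T g = 0 := by
  rw [single_mul_single, mulSingle, if_neg h]

theorem twist_empty (f : ASU q) : twist q ∅ f = f := by
  simp [twist, weight]
theorem twist_zero (f : ASU q) : twist q {0} f = actK q (actK q f) := by
  simp [twist, weight, pow_succ]
theorem twist_one (f : ASU q) : twist q {1} f = actK q (actK q f) := by
  simp [twist, weight, pow_succ]
theorem twist_zero_one (f : ASU q) :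
    twist q {0, 1} f = actK q (actK q (actK q (actK q f))) := by
  simp [twist, weight, pow_succ]

theorem single_zero_mul_one (f g : ASU q) :
    single {0} f * single {1} g = single {0, 1} (f * actK q (actK q g)) := by
  rw [single_mul_single, mulSingle, if_pos (by decide),
    show ({0} ∪ {1} : Finset (Fin 3)) = {0, 1} by decide, twist_zero]
  simp [wedgeCoef, swap]

theorem single_one_mul_zero (f g : ASU q) :
    single {1} f * single {0} g = single {0, 1} (-(Q q ^ 2 • (f * actK q (actK q g)))) := by
  rw [single_mul_single, mulSingle, if_pos (by decide),
    show ({1} ∪ {0} : Finset (Fin 3)) = {0, 1} by decide, twist_one]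
  simp [wedgeCoef, swap]

theorem single_mul_zero_zero (f g : ASU q) : single {0} f * single {0} g = 0 :=
  single_mul_of_not_disjoint (by decide) f g
theorem single_mul_one_one (f g : ASU q) : single {1} f * single {1} g = 0 :=
  single_mul_of_not_disjoint (by decide) f g
theorem single_mul_zero_top (f g : ASU q) : single {0} f * single {0, 1} g = 0 :=
  single_mul_of_not_disjoint (by decide) f g
theorem single_mul_one_top (f g : ASU q) : single {1} f * single {0, 1} g = 0 :=
  single_mul_of_not_disjoint (by decide) f g
theorem single_mul_top_zero (f g : ASU q) : single {0, 1} f * single {0} g = 0 :=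
  single_mul_of_not_disjoint (by decide) f g
theorem single_mul_top_one (f g : ASU q) : single {0, 1} f * single {1} g = 0 :=
  single_mul_of_not_disjoint (by decide) f g
theorem single_mul_top_top (f g : ASU q) : single {0, 1} f * single {0, 1} g = 0 :=
  single_mul_of_not_disjoint (by decide) f g

theorem omList_empty : omList q (toList ∅) = single ∅ 1 := rfl
theorem toList_zero : toList {0} = [0] := by decide
theorem toList_one : toList {1} = [1] := by decide
theorem toList_zero_one : toList {0, 1} = [0, 1] := by decide

theorem om_mul (s t : Fin 3) :
    om q s * om q t = mulSingle {s} {t} 1 1 := single_mul_single _ _ _ _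

theorem om_zero_one : om q 0 * om q 1 = single {0, 1} 1 := by
  rw [om, om, single_zero_mul_one]; simp
theorem om_one_zero : om q 1 * om q 0 = -(Q q ^ 2) • single {0, 1} 1 := by
  rw [om, om, single_one_mul_zero, ← map_smul]; simp

theorem om_two_zero : om q 2 * om q 0 = -(Q q ^ 4) • single {0, 2} 1 := by
  rw [om_mul, mulSingle, if_pos (by decide),
    show ({2} ∪ {0} : Finset (Fin 3)) = {0, 2} by decide, ← map_smul]
  simp [wedgeCoef, swap]
theorem om_two_one : om q 2 * om q 1 = -((Q q)⁻¹ ^ 4) • single {1, 2} 1 := by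
  rw [om_mul, mulSingle, if_pos (by decide),
    show ({2} ∪ {1} : Finset (Fin 3)) = {1, 2} by decide, ← map_smul]
  simp [wedgeCoef, swap]

theorem om_mul_self (s : Fin 3) : om q s * om q s = 0 :=
  single_mul_of_not_disjoint (by simp) _ _

theorem sum_comp_coef_single {V : Type*} [AddCommGroup V] [Module ℂ V]
    (φ : Finset (Fin 3) → ASU q →ₗ[ℂ] V) (S : Finset (Fin 3)) (f : ASU q) :
    (∑ T, (φ T).comp (coef T)) (single S f) = φ S f := by
  rw [LinearMap.sum_apply, Finset.sum_eq_single S]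
  · rw [LinearMap.comp_apply, coef_single_same]
  · intro T _ hT
    rw [LinearMap.comp_apply, coef_single_ne hT, map_zero]
  · simp

theorem del_single (S : Finset (Fin 3)) (f : ASU q) :
    del q (single S f) = single ∅ (Xp q f) * (om q 1 * omList q (toList S)) :=
  sum_comp_coef_single (fun S => (LinearMap.mulRight ℂ (om q 1 * omList q (toList S))).comp
    ((ofFun q).toLinearMap.comp (Xp q))) S f

theorem delbar_single (S : Finset (Fin 3)) (f : ASU q) :
    delbar q (single S f) = single ∅ (Xm q f) * (om q 0 * omList q (toList S)) :=
  sum_comp_coef_single (fun S => (LinearMap.mulRight ℂ (om q 0 * omList q (toList S))).comp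
    ((ofFun q).toLinearMap.comp (Xm q))) S f

theorem d_single (S : Finset (Fin 3)) (f : ASU q) :
    d q (single S f) = (∑ s : Fin 3, single ∅ (X q s f) * (om q s * omList q (toList S)))
      + single ∅ f * dList q (toList S) := by
  have h := sum_comp_coef_single (fun S =>
    (∑ s : Fin 3, (LinearMap.mulRight ℂ (om q s * omList q (toList S))).comp
        ((ofFun q).toLinearMap.comp (X q s)))
      + (LinearMap.mulRight ℂ (dList q (toList S))).comp (ofFun q).toLinearMap) S f
  refine Eq.trans ?_ (h.trans ?_)
  · refine congrArg (fun φ : Forms q →ₗ[ℂ] Forms q => φ (single S f))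
      (Finset.sum_congr rfl fun T _ => ?_)
    refine LinearMap.ext fun z => ?_
    simp only [LinearMap.comp_apply, LinearMap.add_apply, LinearMap.sum_apply]
  · simp only [LinearMap.add_apply, LinearMap.sum_apply]
    rfl

theorem st_single (S : Finset (Fin 3)) (f : ASU q) :
    st q (single S f) = starList q (toList S) * single ∅ (star f) := by
  change ∑ T, starList q (toList T) * ofFun q (star (coef T (single S f))) = _
  rw [Finset.sum_eq_single S]
  · rw [coef_single_same]; rfl
  · intro T _ hT
    rw [coef_single_ne hT, star_zero, map_zero, mul_zero]
  · simp

theorem coaction_single (S : Finset (Fin 3)) (f : ASU q) :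
    coaction q (single S f) = (single S).lTensor (ASU q) (comul q f) :=
  sum_comp_coef_single (fun S => ((single S).lTensor (ASU q)).comp (comul q).toLinearMap) S f

/-! ### Forms without `ω_z` -/

theorem del_fun (f : ASU q) : del q (single ∅ f) = single {1} (Xp q f) := by
  rw [del_single, omList_empty, om, single_mul_empty, single_empty_mul]; simp
theorem delbar_fun (f : ASU q) : delbar q (single ∅ f) = single {0} (Xm q f) := by
  rw [delbar_single, omList_empty, om, single_mul_empty, single_empty_mul]; simp
-- The factor `-q²` comes from reordering `ω₊ ∧ ω₋` into the basis form `ω₋ ∧ ω₊`.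
theorem del_zero (f : ASU q) :
    del q (single {0} f) = single {0, 1} (-(Q q ^ 2 • Xp q f)) := by
  rw [del_single, toList_zero, omList, List.map_singleton, List.prod_singleton, om_one_zero,
    mul_smul_comm, single_empty_mul, mul_one, ← map_smul, neg_smul]
theorem delbar_one (f : ASU q) : delbar q (single {1} f) = single {0, 1} (Xm q f) := by
  rw [delbar_single, toList_one, omList, List.map_singleton, List.prod_singleton, om_zero_one,
    single_empty_mul, mul_one]
theorem del_one (f : ASU q) : del q (single {1} f) = 0 := by
  rw [del_single, toList_one, omList, List.map_singleton, List.prod_singleton, om_mul_self,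
    mul_zero]
theorem delbar_zero (f : ASU q) : delbar q (single {0} f) = 0 := by
  rw [delbar_single, toList_zero, omList, List.map_singleton, List.prod_singleton, om_mul_self,
    mul_zero]
theorem omList_zero_one : omList q [0, 1] = single {0, 1} 1 := by
  simp [omList, om_zero_one]
theorem del_zero_one (f : ASU q) : del q (single {0, 1} f) = 0 := by
  rw [del_single, toList_zero_one, omList_zero_one, om, single_mul_of_not_disjoint (by decide),
    mul_zero]
theorem delbar_zero_one (f : ASU q) : delbar q (single {0, 1} f) = 0 := by
  rw [delbar_single, toList_zero_one, omList_zero_one, om, single_mul_of_not_disjoint (by decide),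
    mul_zero]

theorem st_fun (f : ASU q) : st q (single ∅ f) = single ∅ (star f) := by
  rw [st_single]
  exact one_mul _
theorem st_zero (f : ASU q) :
    st q (single {0} f) = single {1} (-(actK q (actK q (star f)))) := by
  rw [st_single, toList_zero]
  simp [starList, starOm, om, single_mul_empty, twist_one]
theorem st_one (f : ASU q) :
    st q (single {1} f) = single {0} (-(actK q (actK q (star f)))) := by
  rw [st_single, toList_one]
  simp [starList, starOm, om, single_mul_empty, twist_zero]
theorem st_zero_one (f : ASU q) :
    st q (single {0, 1} f)
      = single {0, 1} (-(actK q (actK q (actK q (actK q (star f)))))) := by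
  rw [st_single, toList_zero_one]
  simp [starList, starOm, om_zero_one, single_mul_empty, twist_zero_one]

theorem d_fun (f : ASU q) :
    d q (single ∅ f) = single {0} (Xm q f) + single {1} (Xp q f) + single {2} (Xz q f) := by
  rw [d_single, Fin.sum_univ_three, omList_empty]
  simp only [show toList ∅ = [] from rfl, dList, mul_zero, add_zero, om, single_mul_empty,
    single_empty_mul]
  simp [X]

/-- The `X₋`-term dies with `ω₋ ∧ ω₋`, the `X₊`-term is `∂`, and the `X_z`-term combines with `f
dω₋` into one multiple of `ω_z ∧ ω₋`. -/
theorem d_zero (f : ASU q) :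
    d q (single {0} f) = del q (single {0} f)
      + single ∅ (Xz q f - (1 + (Q q)⁻¹ ^ 2) • f) * (om q 2 * om q 0) := by
  rw [d_single, Fin.sum_univ_three, del_single, toList_zero]
  simp only [dList, omList, List.map_singleton, List.prod_singleton, List.map_nil, List.prod_nil,
    om_mul_self, mul_zero, mul_one, zero_add, sub_zero, dOm, if_true, X, map_sub, sub_mul,
    map_smul, smul_mul_assoc, mul_neg, mul_smul_comm]
  simp
  abel

theorem d_one (f : ASU q) :
    d q (single {1} f) = delbar q (single {1} f)
      + single ∅ (Xz q f + (Q q ^ 2 * (1 + Q q ^ 2)) • f) * (om q 2 * om q 1) := by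
  rw [d_single, Fin.sum_univ_three, delbar_single, toList_one]
  simp only [dList, omList, List.map_singleton, List.prod_singleton, List.map_nil, List.prod_nil,
    om_mul_self, mul_zero, mul_one, add_zero, sub_zero, dOm, if_true, X, map_add, add_mul,
    map_smul, smul_mul_assoc, mul_neg, mul_smul_comm]
  simp
  abel

/-- Both `dω₋ ∧ ω₊` and `ω₋ ∧ dω₊` equal `-(1 + q⁻²) ω₋ ∧ ω₊ ∧ ω_z`, so `ω₋ ∧ ω₊` is closed. -/
theorem dList_zero_one : dList q [0, 1] = 0 := by
  have hQ := Q_ne q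
  simp only [dList, omList, dOm, List.map_singleton, List.prod_singleton, List.map_nil,
    List.prod_nil, mul_one, mul_zero, sub_zero, if_true, one_ne_zero, if_false]
  rw [om_two_zero, om_two_one, om]
  simp only [smul_mul_assoc, mul_smul_comm, neg_mul, om]
  rw [single_mul_single, single_mul_single, mulSingle, mulSingle, if_pos (by decide),
    if_pos (by decide), show ({0, 2} ∪ {1} : Finset (Fin 3)) = {0, 1, 2} by decide,
    show ({0} ∪ {1, 2} : Finset (Fin 3)) = {0, 1, 2} by decide]
  simp only [map_one, mul_one, map_smul, smul_smul, ← neg_smul, ← sub_smul]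
  convert zero_smul ℂ _
  simp [wedgeCoef, swap]
  field_simp
  ring

theorem d_zero_one (f : ASU q) (hf : Xz q f = 0) : d q (single {0, 1} f) = 0 := by
  rw [d_single, Fin.sum_univ_three, toList_zero_one, omList_zero_one, dList_zero_one]
  simp only [X, om]
  rw [single_mul_of_not_disjoint (S := {0}) (by decide),
    single_mul_of_not_disjoint (S := {1}) (by decide)]
  simp [hf]

/-! ### Cancellation of the `ω_z`-terms in the relevant degrees -/

theorem Xz_of_mem_homog {n : ℤ} {x : ASU q} (hx : x ∈ homog q n) :
    Xz q x = ((1 - Q q ^ (-2 * n)) / (1 - (Q q)⁻¹ ^ 2)) • x := by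
  rw [Xz_of_actK (actK_of_mem_homog hx), ← sq_mul, mul_zpow, ← zpow_add₀ (sq_ne q), ← zpow_natCast,
    ← zpow_mul]
  congr 4
  push_cast
  ring

theorem d_of_homog_zero {f : ASU q} (hf : f ∈ homog q 0) :
    d q (single ∅ f) = single {0} (Xm q f) + single {1} (Xp q f) := by
  have h : Xz q f = 0 := by rw [Xz_of_mem_homog hf]; simp
  rw [d_fun, h, map_zero, add_zero]

theorem d_eq_fun {f : ASU q} (hf : f ∈ homog q 0) :
    d q (single ∅ f) = del q (single ∅ f) + delbar q (single ∅ f) := by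
  rw [d_of_homog_zero hf, del_fun, delbar_fun, add_comm]

theorem d_eq_zero {x : ASU q} (hx : x ∈ homog q 2) :
    d q (single {0} x) = del q (single {0} x) + delbar q (single {0} x) := by
  -- In degree 2 the eigenvalue of `X_z` is `(1 - q⁻⁴)/(1 - q⁻²) = 1 + q⁻²`, opposite to the scalar
  -- in `dω₋`.
  have h : Xz q x - (1 + (Q q)⁻¹ ^ 2) • x = 0 := by
    have hne := one_sub_inv_ne (q := q)
    rw [Xz_of_mem_homog hx, ← sub_smul]
    convert zero_smul ℂ x
    rw [sub_eq_zero, div_eq_iff hne]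
    rw [show (-2 * 2 : ℤ) = -4 by norm_num, zpow_neg]
    norm_cast
    rw [inv_pow]
    ring
  rw [d_zero, h, delbar_zero]
  simp

theorem d_eq_one {y : ASU q} (hy : y ∈ homog q (-2)) :
    d q (single {1} y) = del q (single {1} y) + delbar q (single {1} y) := by
  -- In degree -2 the eigenvalue of `X_z` is `(1 - q⁴)/(1 - q⁻²) = -q²(1 + q²)`, opposite to the
  -- scalar in `dω₊`.
  have h : Xz q y + (Q q ^ 2 * (1 + Q q ^ 2)) • y = 0 := by
    have hne := one_sub_inv_ne (q := q)
    have hQ := Q_ne q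
    rw [Xz_of_mem_homog hy, ← add_smul]
    convert zero_smul ℂ y
    rw [div_add' _ _ _ hne, div_eq_zero_iff]
    left
    rw [show (-2 * -2 : ℤ) = 4 by norm_num]
    norm_cast
    field_simp
    ring
  rw [d_one, h, del_one]
  simp

theorem d_eq_zero_one {f : ASU q} (hf : f ∈ homog q 0) :
    d q (single {0, 1} f) = del q (single {0, 1} f) + delbar q (single {0, 1} f) := by
  rw [d_zero_one f (by rw [Xz_of_mem_homog hf]; simp), del_zero_one, delbar_zero_one, add_zero]

/-! ### The left coaction -/

theorem comul_actK (f : ASU q) :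
    comul q (actK q f) = Algebra.TensorProduct.map (AlgHom.id ℂ _) (actK q) (comul q f) := by
  have h : (comul q).comp (actK q)
      = (Algebra.TensorProduct.map (AlgHom.id ℂ _) (actK q)).comp (comul q) := by
    apply hom_ext
    intro g
    have := sq_ne q
    cases g <;> simp [actK_a, actK_as, actK_c, actK_cs, comul, comulGen, smul_sub, smul_add,
      TensorProduct.tmul_smul, smul_comm (Q q)]
  exact DFunLike.congr_fun h f

theorem comul_actK_pow (n : ℕ) (f : ASU q) :
    comul q ((actK q ^ n) f)
      = Algebra.TensorProduct.map (AlgHom.id ℂ _) (actK q ^ n) (comul q f) := by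
  induction n with
  | zero =>
    rw [pow_zero]
    exact (DFunLike.congr_fun (Algebra.TensorProduct.map_id (R := ℂ) (A := ASU q) (B := ASU q)) _).symm
  | succ n ih =>
    rw [pow_succ', AlgHom.mul_apply, comul_actK, ih]
    generalize comul q f = t
    induction t using TensorProduct.induction_on with
    | zero => simp
    | add t t' h h' => simp only [map_add, h, h']
    | tmul x y => simp

theorem lTensor_twisted {D : ASU q →ₗ[ℂ] ASU q} {k : ℕ}
    (hD : ∀ x y, D (x * y) = x * D y + D x * (actK q ^ k) y) (s t : ASU q ⊗[ℂ] ASU q) :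
    D.lTensor (ASU q) (s * t) = s * D.lTensor (ASU q) t
      + D.lTensor (ASU q) s * Algebra.TensorProduct.map (AlgHom.id ℂ _) (actK q ^ k) t := by
  induction s using TensorProduct.induction_on with
  | zero => simp
  | add s s' h h' => simp only [add_mul, map_add, h, h']; abel
  | tmul x y =>
    induction t using TensorProduct.induction_on with
    | zero => simp
    | add t t' h h' => simp only [mul_add, map_add, h, h']; abel
    | tmul x' y' => simp [hD, TensorProduct.tmul_add]

/-- For an operator acting through the second leg this is coassociativity. Here it is reduced to
generators, because both sides are derivations over the coproduct with the same twist `K^k`. -/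
theorem comul_twisted {D : ASU q →ₗ[ℂ] ASU q} {k : ℕ}
    (hD : ∀ x y, D (x * y) = x * D y + D x * (actK q ^ k) y)
    (hg : ∀ g, comul q (D (gen q g)) = D.lTensor (ASU q) (comul q (gen q g))) (f : ASU q) :
    comul q (D f) = D.lTensor (ASU q) (comul q f) := by
  have h1 : D 1 = 0 := by simpa using hD 1 1
  refine twisted_ext (D := (comul q).toLinearMap.comp D)
    (D' := (D.lTensor (ASU q)).comp (comul q).toLinearMap) (comul q)
    (fun y => comul q ((actK q ^ k) y)) ?_ ?_ ?_ hg f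
  · simp [h1, Algebra.TensorProduct.one_def]
  · intro x y
    simp only [LinearMap.comp_apply, AlgHom.toLinearMap_apply, hD, map_add, map_mul]
  · intro x y
    simp only [LinearMap.comp_apply, AlgHom.toLinearMap_apply, map_mul, lTensor_twisted hD,
      comul_actK_pow]

theorem comul_Xp (f : ASU q) : comul q (Xp q f) = (Xp q).lTensor (ASU q) (comul q f) := by
  refine comul_twisted Xp_mul (fun g => ?_) f
  have := sq_ne q
  cases g <;> simp [Xp_a, Xp_as, Xp_c, Xp_cs, comul, comulGen, TensorProduct.tmul_neg,
    TensorProduct.tmul_smul, smul_add, add_comm]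
  all_goals abel

theorem comul_Xm (f : ASU q) : comul q (Xm q f) = (Xm q).lTensor (ASU q) (comul q f) := by
  refine comul_twisted Xm_mul (fun g => ?_) f
  have := Q_ne q
  cases g <;> simp [Xm_a, Xm_as, Xm_c, Xm_cs, comul, comulGen, TensorProduct.tmul_neg,
    TensorProduct.tmul_smul, smul_add, smul_sub, smul_smul, this, add_comm]
  all_goals abel

theorem comul_Xz (f : ASU q) : comul q (Xz q f) = (Xz q).lTensor (ASU q) (comul q f) := by
  have h := comul_actK_pow 4 f
  simp only [Xz, LinearMap.smul_apply, LinearMap.sub_apply, LinearMap.id_apply, map_smul, map_sub,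
    AlgHom.toLinearMap_apply, h, LinearMap.lTensor_smul, LinearMap.lTensor_sub,
    LinearMap.lTensor_id]
  rfl

theorem comul_X (s : Fin 3) (f : ASU q) :
    comul q (X q s f) = (X q s).lTensor (ASU q) (comul q f) := by
  unfold X
  split_ifs
  · exact comul_Xm f
  · exact comul_Xp f
  · exact comul_Xz f

/-- Moving a function through `ω_S` applies a power of `K`, and the coproduct carries that power to
the second leg, where the product of forms performs the same twist. -/
theorem coaction_mul (x y : Forms q) : coaction q (x * y) = coaction q x * coaction q y := by
  induction x using Forms.induction with
  | hadd x x' h h' => rw [add_mul, map_add, map_add, add_mul, h, h']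
  | h S f =>
    induction y using Forms.induction with
    | hadd y y' h h' => rw [mul_add, map_add, map_add, mul_add, h, h']
    | h T g =>
      rw [single_mul_single, coaction_single, coaction_single]
      have key : ∀ s t : ASU q ⊗[ℂ] ASU q,
          (single S).lTensor (ASU q) s * (single T).lTensor (ASU q) t
          = if Disjoint S T then (single (S ∪ T)).lTensor (ASU q) (wedgeCoef q S T •
              (s * Algebra.TensorProduct.map (AlgHom.id ℂ _) (twist q S) t)) else 0 := by
        intro s t
        induction s using TensorProduct.induction_on with
        | zero => simp
        | add s s' h h' => rw [map_add, add_mul, h, h']; split_ifs <;> simp [add_mul]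
        | tmul x y =>
          induction t using TensorProduct.induction_on with
          | zero => simp
          | add t t' h h' => rw [map_add, mul_add, h, h']; split_ifs <;> simp [mul_add]
          | tmul x' y' =>
            simp only [LinearMap.lTensor_tmul, Algebra.TensorProduct.tmul_mul_tmul,
              single_mul_single, mulSingle]
            split_ifs <;> simp
      rw [key, mulSingle]
      split_ifs with h
      · rw [coaction_single, map_smul, map_mul, twist, comul_actK_pow]
      · simp

/-- The left-invariant forms. -/
noncomputable def invariant (q : Set.Ioo (0 : ℝ) 1) : Subalgebra ℂ (Forms q) where
  carrier := {x | coaction q x = 1 ⊗ₜ x}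
  mul_mem' {x y} hx hy := by
    change coaction q (x * y) = _
    rw [coaction_mul, hx, hy, Algebra.TensorProduct.tmul_mul_tmul, one_mul]
  add_mem' {x y} hx hy := by
    change coaction q (x + y) = _
    rw [map_add, hx, hy, TensorProduct.tmul_add]
  algebraMap_mem' z := by
    change coaction q (algebraMap ℂ (Forms q) z) = _
    rw [Algebra.algebraMap_eq_smul_one, map_smul, one_def, coaction_single, map_one,
      Algebra.TensorProduct.one_def, LinearMap.lTensor_tmul, TensorProduct.tmul_smul]

theorem om_mem_invariant (s : Fin 3) : om q s ∈ invariant q := by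
  change coaction q (single {s} 1) = _
  rw [coaction_single, map_one, Algebra.TensorProduct.one_def, LinearMap.lTensor_tmul]
  rfl

theorem omList_mem_invariant (l : List (Fin 3)) : omList q l ∈ invariant q := by
  refine Subalgebra.list_prod_mem _ fun x hx => ?_
  obtain ⟨s, _, rfl⟩ := List.mem_map.1 hx
  exact om_mem_invariant s

theorem dList_mem_invariant (l : List (Fin 3)) : dList q l ∈ invariant q := by
  induction l with
  | nil => exact zero_mem _
  | cons s l ih =>
    refine sub_mem (mul_mem ?_ (omList_mem_invariant l)) (mul_mem (om_mem_invariant s) ih)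
    have h := fun s t => mul_mem (om_mem_invariant (q := q) s) (om_mem_invariant t)
    unfold dOm
    split_ifs
    · exact neg_mem (Subalgebra.smul_mem _ (h 2 0) _)
    · exact Subalgebra.smul_mem _ (h 2 1) _
    · exact neg_mem (h 0 1)

/-- An invariant factor on the right is inert under the coaction, so only the coproduct of the
coefficient matters. -/
theorem coaction_mul_invariant {η : Forms q} (hη : η ∈ invariant q) (f : ASU q) :
    coaction q (single ∅ f * η)
      = ((LinearMap.mulRight ℂ η).comp (single ∅)).lTensor (ASU q) (comul q f) := by
  rw [coaction_mul, coaction_single, show coaction q η = 1 ⊗ₜ η from hη]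
  generalize comul q f = t
  induction t using TensorProduct.induction_on with
  | zero => simp
  | add t t' h h' => simp only [map_add, add_mul, h, h']
  | tmul x y => simp

theorem coaction_d (x : Forms q) :
    coaction q (d q x) = (d q).lTensor (ASU q) (coaction q x) := by
  induction x using Forms.induction with
  | hadd x x' h h' => simp only [map_add, h, h']
  | h S f =>
    -- As a map of the coefficient, the differential of `f ω_S` is a sum of vector fields followed
    -- by right multiplication by invariant forms; each summand then commutes with the coaction.
    have hd : (d q).comp (single S)
        = (∑ s : Fin 3, ((LinearMap.mulRight ℂ (om q s * omList q (toList S))).comp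
          (single ∅)).comp (X q s)) + (LinearMap.mulRight ℂ (dList q (toList S))).comp
          (single ∅) := by
      refine LinearMap.ext fun g => ?_
      simp only [LinearMap.comp_apply, LinearMap.add_apply, LinearMap.sum_apply,
        LinearMap.mulRight_apply]
      rw [d_single]
    rw [coaction_single, ← LinearMap.lTensor_comp_apply,
      hd, d_single, map_add, map_sum, LinearMap.lTensor_add, LinearMap.add_apply,
      coaction_mul_invariant (dList_mem_invariant _)]
    congr 1
    rw [Fin.sum_univ_three, Fin.sum_univ_three, LinearMap.lTensor_add, LinearMap.lTensor_add]
    simp only [LinearMap.add_apply, coaction_mul_invariant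
      (mul_mem (om_mem_invariant _) (omList_mem_invariant _)), comul_X]
    simp only [LinearMap.lTensor_comp, LinearMap.comp_apply]

end Forms

end QuantumProjectiveLine

namespace QuantumProjectiveLine

open ASU Forms

variable {q : Set.Ioo (0 : ℝ) 1}

/-! ### Generators of the projective line -/

namespace ASU

theorem twist_of_mem_homog {n : ℤ} {x : ASU q} (hx : x ∈ homog q n) :
    actK q (actK q x) = Q q ^ (-n) • x := by
  rw [actK_of_mem_homog hx, map_smul, actK_of_mem_homog hx, smul_smul, ← sq_mul, mul_zpow]

theorem Xp_cas : Xp q (gen q .c * gen q .as) = Q q • (gen q .as * gen q .as) := by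
  simp [Xp_mul, Xp_c, Xp_as, actK_sq_apply, actK_as, smul_smul, sq_mul]
theorem Xp_ccs : Xp q (gen q .c * gen q .cs) = Q q • (gen q .as * gen q .cs) := by
  simp [Xp_mul, Xp_c, Xp_cs, actK_sq_apply, actK_cs, smul_smul, sq_mul]
theorem Xp_acs : Xp q (gen q .a * gen q .cs) = -(Q q ^ 2 • (gen q .cs * gen q .cs)) := by
  simp [Xp_mul, Xp_a, Xp_cs, actK_sq_apply, actK_cs, smul_smul, sq_mul, pow_two]
theorem Xm_cas : Xm q (gen q .c * gen q .as) = gen q .c * gen q .c := by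
  simp [Xm_mul, Xm_c, Xm_as]
theorem Xm_ccs : Xm q (gen q .c * gen q .cs) = -((Q q)⁻¹ • (gen q .c * gen q .a)) := by
  simp [Xm_mul, Xm_c, Xm_cs]
theorem Xm_acs : Xm q (gen q .a * gen q .cs) = -((Q q)⁻¹ • (gen q .a * gen q .a)) := by
  simp [Xm_mul, Xm_a, Xm_cs]

theorem mul_swap {x y : ASU q} {z : ℂ} (h : x * y = z • (y * x)) (w : ASU q) :
    x * (y * w) = z • (y * (x * w)) := by
  rw [← mul_assoc, h, smul_mul_assoc, mul_assoc]

theorem mul_asa (w : ASU q) : gen q .as * (gen q .a * w) = w - gen q .cs * (gen q .c * w) := by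
  rw [← mul_assoc, n_asa, sub_mul, one_mul, mul_assoc]
theorem mul_aas (w : ASU q) :
    gen q .a * (gen q .as * w) = w - Q q ^ 2 • (gen q .cs * (gen q .c * w)) := by
  rw [← mul_assoc, n_aas, sub_mul, one_mul, smul_mul_assoc, mul_assoc]
theorem mul_ccs (w : ASU q) : gen q .c * (gen q .cs * w) = gen q .cs * (gen q .c * w) := by
  rw [← mul_assoc, r_ccs, mul_assoc]

theorem inv_rel {x y : ASU q} (h : x * y = Q q • (y * x)) : y * x = (Q q)⁻¹ • (x * y) := by
  rw [h, smul_smul, inv_mul_cancel₀ (Q_ne q), one_smul]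

theorem mem_homog_two {n : ℤ} (g h : Gen) (hn : Gen.deg g + Gen.deg h = n) :
    gen q g * gen q h ∈ homog q n :=
  hn ▸ mul_mem_homog (gen_mem_homog g) (gen_mem_homog h)

/-- Together with `sum_Xm_eq_zero`: `ω₊` is a combination of differentials of functions on the
projective line, with coefficients of degree `2`. -/
theorem sum_Xp_eq_one :
    (Q q)⁻¹ • (gen q .a * gen q .a * Xp q (gen q .c * gen q .as))
      + (Q q + Q q ^ 3) • (gen q .c * gen q .a * Xp q (gen q .c * gen q .cs))
      - Q q ^ 2 • (gen q .c * gen q .c * Xp q (gen q .a * gen q .cs)) = 1 := by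
  have hQ := Q_ne q
  -- The sum becomes `a²a^{*2} + (q² + q⁴) ca a^*c^* + q⁴ c²c^{*2}`. This is the expansion of
  -- `a(aa^* + q²cc^*)a^* + q² c(aa^* + q²cc^*)c^* = 1`, which explains the coefficients.
  rw [Xp_cas, Xp_ccs, Xp_acs]
  simp only [mul_assoc, mul_smul_comm, smul_smul, mul_neg, smul_neg, mul_swap r_ac, mul_swap r_acs,
    mul_swap r_csas, mul_swap r_cas, mul_aas, mul_ccs, r_ac, r_acs, r_csas, r_cas, r_ccs, n_aas,
    mul_sub, smul_sub, mul_one]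
  match_scalars <;> field_simp <;> ring

/-- With the same coefficients every term is a multiple of `c²a²`, with factors `q³`, `-(q + q³)`
and `q`. -/
theorem sum_Xm_eq_zero :
    (Q q)⁻¹ • (gen q .a * gen q .a * Xm q (gen q .c * gen q .as))
      + (Q q + Q q ^ 3) • (gen q .c * gen q .a * Xm q (gen q .c * gen q .cs))
      - Q q ^ 2 • (gen q .c * gen q .c * Xm q (gen q .a * gen q .cs)) = 0 := by
  have hQ := Q_ne q
  rw [Xm_cas, Xm_ccs, Xm_acs]
  simp only [mul_assoc, mul_smul_comm, smul_smul, mul_neg, smul_neg, mul_swap r_ac, r_ac]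
  match_scalars
  field_simp
  ring

/-- Together with `sum_Xp_eq_zero`: `ω₋` is a combination of differentials of functions on the
projective line, with coefficients of degree `-2`. -/
theorem sum_Xm_eq_one :
    (gen q .cs * gen q .cs * Xm q (gen q .c * gen q .as))
      - (Q q + Q q ^ 3) • (gen q .as * gen q .cs * Xm q (gen q .c * gen q .cs))
      - Q q • (gen q .as * gen q .as * Xm q (gen q .a * gen q .cs)) = 1 := by
  have hQ := Q_ne q
  -- The sum becomes `c^{*2}c² + (1 + q²) a^*c^*ca + a^{*2}a²`, the expansion of `a^*(a^*a + c^*c)a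
  -- + c^*(a^*a + c^*c)c = 1`.
  rw [Xm_cas, Xm_ccs, Xm_acs]
  simp only [mul_assoc, mul_smul_comm, smul_smul, mul_neg, smul_neg, mul_swap (inv_rel r_ac),
    mul_swap (inv_rel r_acs), mul_swap (inv_rel r_csas), mul_swap (inv_rel r_cas), mul_asa,
    mul_ccs, inv_rel r_ac, inv_rel r_acs, inv_rel r_csas, inv_rel r_cas, r_ccs, n_asa,
    mul_sub, smul_sub, mul_one, smul_mul_assoc]
  match_scalars <;> field_simp <;> ring

/-- Every term is a multiple of `a^{*2}c^{*2}`, with factors `q⁵`, `-(q³ + q⁵)` and `q³`. -/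
theorem sum_Xp_eq_zero :
    (gen q .cs * gen q .cs * Xp q (gen q .c * gen q .as))
      - (Q q + Q q ^ 3) • (gen q .as * gen q .cs * Xp q (gen q .c * gen q .cs))
      - Q q • (gen q .as * gen q .as * Xp q (gen q .a * gen q .cs)) = 0 := by
  have hQ := Q_ne q
  rw [Xp_cas, Xp_ccs, Xp_acs]
  simp only [mul_assoc, mul_smul_comm, smul_smul, mul_neg, smul_neg, mul_swap r_csas, r_csas]
  match_scalars
  field_simp
  ring

end ASU

/-! ### The homogeneous components of the calculus -/

theorem incl_apply (f : CP q) : incl q f = single ∅ (f : ASU q) := rfl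

theorem CP_mem_homog (f : CP q) : (f : ASU q) ∈ homog q 0 := mem_CP_iff.1 f.2

theorem d_incl (f : CP q) :
    d q (incl q f) = single {0} (Xm q f) + single {1} (Xp q f) :=
  d_of_homog_zero (CP_mem_homog f)

theorem mul_mem_homog' {m n k : ℤ} {x y : ASU q} (hx : x ∈ homog q m) (hy : y ∈ homog q n)
    (h : m + n = k) : x * y ∈ homog q k := h ▸ mul_mem_homog hx hy

theorem Xp_mem {f : ASU q} (hf : f ∈ homog q 0) : Xp q f ∈ homog q (-2) := by
  simpa using Xp_mem_homog hf
theorem Xm_mem {f : ASU q} (hf : f ∈ homog q 0) : Xm q f ∈ homog q 2 := by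
  simpa using Xm_mem_homog hf

theorem Xp_mem_zero {x : ASU q} (hx : x ∈ homog q 2) : Xp q x ∈ homog q 0 := by
  simpa using Xp_mem_homog hx
theorem Xm_mem_zero {y : ASU q} (hy : y ∈ homog q (-2)) : Xm q y ∈ homog q 0 := by
  simpa using Xm_mem_homog hy

theorem mem_OmegaCP_zero {w : Forms q} :
    w ∈ OmegaCP q 0 ↔ ∃ f ∈ homog q 0, w = single ∅ f := by
  constructor
  · intro h
    have : OmegaCP q 0 ≤ (homog q 0).map (single ∅) := by
      refine Submodule.span_le.2 ?_
      rintro _ ⟨f, g, rfl⟩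
      exact ⟨f, CP_mem_homog f, by simp [incl_apply]⟩
    obtain ⟨f, hf, rfl⟩ := this h
    exact ⟨f, hf, rfl⟩
  · rintro ⟨f, hf, rfl⟩
    exact Submodule.subset_span ⟨⟨f, mem_CP_iff.2 hf⟩, fun k => k.elim0, by simp [incl_apply]⟩

theorem fun_mul_d_mem {f g : ASU q} (hf : f ∈ homog q 0) (hg : g ∈ homog q 0) :
    single {0} (f * Xm q g) + single {1} (f * Xp q g) ∈ OmegaCP q 1 := by
  refine Submodule.subset_span ⟨⟨f, mem_CP_iff.2 hf⟩, fun _ => ⟨g, mem_CP_iff.2 hg⟩, ?_⟩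
  simp only [List.ofFn_succ, List.ofFn_zero, List.prod_cons, List.prod_nil, mul_one, d_incl]
  simp only [incl_apply, mul_add, single_empty_mul]

theorem combination_mem_OmegaCP_one {f₁ f₂ f₃ : ASU q} (h₁ : f₁ ∈ homog q 0)
    (h₂ : f₂ ∈ homog q 0) (h₃ : f₃ ∈ homog q 0) :
    single {0} (f₁ * Xm q (gen q .c * gen q .as) + f₂ * Xm q (gen q .c * gen q .cs)
        + f₃ * Xm q (gen q .a * gen q .cs))
      + single {1} (f₁ * Xp q (gen q .c * gen q .as) + f₂ * Xp q (gen q .c * gen q .cs)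
        + f₃ * Xp q (gen q .a * gen q .cs)) ∈ OmegaCP q 1 := by
  have e₁ := fun_mul_d_mem h₁ (mem_homog_two .c .as rfl)
  have e₂ := fun_mul_d_mem h₂ (mem_homog_two .c .cs rfl)
  have e₃ := fun_mul_d_mem h₃ (mem_homog_two .a .cs rfl)
  convert add_mem (add_mem e₁ e₂) e₃ using 1
  simp only [map_add]
  abel

/-- Multiply `ω₊ = ∑ uᵢ dgᵢ` on the left by `y`: the coefficients `y uᵢ` have degree 0, so they are
functions on the projective line. The `ω₋`-part vanishes by `sum_Xm_eq_zero`. -/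
theorem single_one_mem {y : ASU q} (hy : y ∈ homog q (-2)) : single {1} y ∈ OmegaCP q 1 := by
  have h := combination_mem_OmegaCP_one
    (Submodule.smul_mem _ (Q q)⁻¹ (mul_mem_homog' hy (mem_homog_two .a .a rfl) rfl))
    (Submodule.smul_mem _ (Q q + Q q ^ 3) (mul_mem_homog' hy (mem_homog_two .c .a rfl) rfl))
    (Submodule.smul_mem _ (-(Q q ^ 2)) (mul_mem_homog' hy (mem_homog_two .c .c rfl) rfl))
  have e0 := congrArg (y * ·) (sum_Xm_eq_zero (q := q))
  have e1 := congrArg (y * ·) (sum_Xp_eq_one (q := q))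
  simp only [mul_add, mul_sub, mul_smul_comm, mul_zero, mul_one] at e0 e1
  simp only [smul_mul_assoc, mul_assoc, neg_smul, neg_mul, ← sub_eq_add_neg] at h e0 e1
  rw [e0, e1, map_zero, zero_add] at h
  exact h

theorem single_zero_mem {x : ASU q} (hx : x ∈ homog q 2) : single {0} x ∈ OmegaCP q 1 := by
  have h := combination_mem_OmegaCP_one
    (mul_mem_homog' hx (mem_homog_two .cs .cs rfl) rfl)
    (Submodule.smul_mem _ (-(Q q + Q q ^ 3)) (mul_mem_homog' hx (mem_homog_two .as .cs rfl) rfl))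
    (Submodule.smul_mem _ (-Q q) (mul_mem_homog' hx (mem_homog_two .as .as rfl) rfl))
  have e0 := congrArg (x * ·) (sum_Xm_eq_one (q := q))
  have e1 := congrArg (x * ·) (sum_Xp_eq_zero (q := q))
  simp only [mul_add, mul_sub, mul_smul_comm, mul_zero, mul_one] at e0 e1
  rw [neg_smul] at h
  simp only [smul_mul_assoc, mul_assoc, neg_smul, neg_mul, ← sub_eq_add_neg] at h e0 e1
  rw [e0, e1, map_zero, add_zero] at h
  exact h

theorem mem_OmegaCP_one {w : Forms q} :
    w ∈ OmegaCP q 1 ↔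
      ∃ x ∈ homog q 2, ∃ y ∈ homog q (-2), w = single {0} x + single {1} y := by
  constructor
  · intro h
    have : OmegaCP q 1 ≤ (homog q 2).map (single {0}) ⊔ (homog q (-2)).map (single {1}) := by
      refine Submodule.span_le.2 ?_
      rintro _ ⟨f, g, rfl⟩
      have hf := CP_mem_homog f
      have hg := CP_mem_homog (g 0)
      refine Submodule.mem_sup.2 ⟨_, ⟨_, mul_mem_homog' hf (Xm_mem hg) rfl, rfl⟩, _,
        ⟨_, mul_mem_homog' hf (Xp_mem hg) rfl, rfl⟩, ?_⟩
      simp only [List.ofFn_succ, List.ofFn_zero, List.prod_cons, List.prod_nil, mul_one, d_incl]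
      simp only [incl_apply, mul_add, single_empty_mul]
    obtain ⟨_, ⟨x, hx, rfl⟩, _, ⟨y, hy, rfl⟩, rfl⟩ := Submodule.mem_sup.1 (this h)
    exact ⟨x, hx, y, hy, rfl⟩
  · rintro ⟨x, hx, y, hy, rfl⟩
    exact add_mem (single_zero_mem hx) (single_one_mem hy)

theorem incl_mul_mem_OmegaCP (f : CP q) {n : ℕ} {w : Forms q} (hw : w ∈ OmegaCP q n) :
    incl q f * w ∈ OmegaCP q n := by
  refine Submodule.span_induction ?_ (by simp) (fun x y _ _ hx hy => by
    rw [mul_add]; exact add_mem hx hy) (fun z x _ hx => by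
    rw [mul_smul_comm]; exact Submodule.smul_mem _ _ hx) hw
  rintro _ ⟨f', g, rfl⟩
  exact Submodule.subset_span ⟨f * f', g, by rw [map_mul, mul_assoc]⟩

/-- The Leibniz rule, in the form that moves a function standing to the right of a differential over
to the left. -/
theorem d_incl_mul (g h : CP q) :
    d q (incl q g) * incl q h = d q (incl q (g * h)) - incl q g * d q (incl q h) := by
  rw [d_incl, d_incl, d_incl, incl_apply, incl_apply]
  simp only [mul_add, add_mul, single_empty_mul, single_mul_empty, twist_zero, twist_one,
    MulMemClass.coe_mul, Xm_mul, Xp_mul, actK_sq_apply, map_add]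
  abel

theorem mul_mem_OmegaCP_two {v w : Forms q} (hv : v ∈ OmegaCP q 1) (hw : w ∈ OmegaCP q 1) :
    v * w ∈ OmegaCP q 2 := by
  refine Submodule.span_induction ?_ (by simp) (fun x y _ _ hx hy => by
    rw [add_mul]; exact add_mem hx hy) (fun z x _ hx => by
    rw [smul_mul_assoc]; exact Submodule.smul_mem _ _ hx) hv
  rintro _ ⟨f, g, rfl⟩
  refine Submodule.span_induction ?_ (by simp) (fun x y _ _ hx hy => by
    rw [mul_add]; exact add_mem hx hy) (fun z x _ hx => by
    rw [mul_smul_comm]; exact Submodule.smul_mem _ _ hx) hw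
  rintro _ ⟨h, k, rfl⟩
  have hdd : ∀ g k : CP q, d q (incl q g) * d q (incl q k) ∈ OmegaCP q 2 := fun g k =>
    Submodule.subset_span ⟨1, fun i => if i = 0 then g else k, by simp⟩
  simp only [List.ofFn_succ, List.ofFn_zero, List.prod_cons, List.prod_nil, mul_one]
  -- The middle function `h` is absorbed by the Leibniz rule, leaving only products of the spanning
  -- shape.
  have e : incl q f * d q (incl q (g 0)) * (incl q h * d q (incl q (k 0)))
      = incl q f * (d q (incl q (g 0 * h)) * d q (incl q (k 0)))
        - incl q f * (incl q (g 0) * (d q (incl q h) * d q (incl q (k 0)))) := by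
    rw [← mul_sub, ← mul_assoc (incl q (g 0)), ← sub_mul, ← d_incl_mul]
    simp only [mul_assoc]
  rw [e]
  have h1 := incl_mul_mem_OmegaCP f (hdd (g 0 * h) (k 0))
  have h2 := incl_mul_mem_OmegaCP f (incl_mul_mem_OmegaCP (g 0) (hdd h (k 0)))
  exact sub_mem h1 h2

theorem d_incl_mul_d_incl (f g : CP q) : ∃ k ∈ homog q 0,
    d q (incl q f) * d q (incl q g) = single {0, 1} k := by
  have hf := CP_mem_homog f
  have hg := CP_mem_homog g
  -- The scalars `q²` and `q⁻²` are the eigenvalues of `K²` on `X₊g` and `X₋g`, picked up when these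
  -- pass through `ω₋` and `ω₊`; the `-q²` reorders `ω₊ ∧ ω₋`.
  refine ⟨_, add_mem
    (mul_mem_homog' (Xm_mem hf) (Submodule.smul_mem _ (Q q ^ (-(-2 : ℤ))) (Xp_mem hg)) rfl)
    (Submodule.smul_mem _ (-(Q q ^ 2))
      (mul_mem_homog' (Xp_mem hf) (Submodule.smul_mem _ (Q q ^ (-2 : ℤ)) (Xm_mem hg)) rfl)), ?_⟩
  rw [← twist_of_mem_homog (Xp_mem hg), ← twist_of_mem_homog (Xm_mem hg), d_incl, d_incl, map_add]
  simp only [mul_add, add_mul, single_zero_mul_one, single_one_mul_zero, neg_smul]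
  rw [single_mul_of_not_disjoint (S := {0}) (T := {0}) (by decide),
    single_mul_of_not_disjoint (S := {1}) (T := {1}) (by decide)]
  abel

/-- Insert `1 = ∑ uᵢ X₊gᵢ` after `f`. Up to a power of q, each term is the product of the one-forms
`f uᵢ ω₋` and `(X₊gᵢ) ω₊`, which already belong to the calculus. -/
theorem single_zero_one_mem {f : ASU q} (hf : f ∈ homog q 0) :
    single {0, 1} f ∈ OmegaCP q 2 := by
  have hQ := Q_ne q
  have key : ∀ {u g : ASU q}, u ∈ homog q 2 → g ∈ homog q 0 →
      single {0, 1} (f * (u * Xp q g)) ∈ OmegaCP q 2 := by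
    intro u g hu hg
    have h := mul_mem_OmegaCP_two (single_zero_mem (mul_mem_homog' hf hu rfl))
      (single_one_mem (Xp_mem hg))
    rw [single_zero_mul_one, twist_of_mem_homog (Xp_mem hg), mul_smul_comm, map_smul] at h
    rw [← mul_assoc]
    exact (Submodule.smul_mem_iff _ (zpow_ne_zero _ hQ)).1 h
  rw [← mul_one f, ← sum_Xp_eq_one, mul_sub, mul_add, mul_smul_comm, mul_smul_comm, mul_smul_comm,
    map_sub, map_add, map_smul, map_smul, map_smul]
  refine sub_mem (add_mem (Submodule.smul_mem _ _ ?_) (Submodule.smul_mem _ _ ?_))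
    (Submodule.smul_mem _ _ ?_)
  · exact key (mem_homog_two .a .a rfl) (mem_homog_two .c .as rfl)
  · exact key (mem_homog_two .c .a rfl) (mem_homog_two .c .cs rfl)
  · exact key (mem_homog_two .c .c rfl) (mem_homog_two .a .cs rfl)

theorem mem_OmegaCP_two {w : Forms q} :
    w ∈ OmegaCP q 2 ↔ ∃ f ∈ homog q 0, w = single {0, 1} f := by
  constructor
  · intro h
    have : OmegaCP q 2 ≤ (homog q 0).map (single {0, 1}) := by
      refine Submodule.span_le.2 ?_
      rintro _ ⟨f, g, rfl⟩
      obtain ⟨k, hk, e⟩ := d_incl_mul_d_incl (g 0) (g 1)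
      refine ⟨f * k, mul_mem_homog' (CP_mem_homog f) hk rfl, ?_⟩
      simp only [List.ofFn_succ, List.ofFn_zero, List.prod_cons, List.prod_nil, mul_one]
      rw [show Fin.succ (0 : Fin 1) = 1 from rfl, e, incl_apply, single_empty_mul]
    obtain ⟨f, hf, rfl⟩ := this h
    exact ⟨f, hf, rfl⟩
  · rintro ⟨f, hf, rfl⟩
    exact single_zero_one_mem hf

/-- Two differentials multiply to a multiple of `ω₋ ∧ ω₊`, which a third differential, having no
`ω_z`-term, annihilates. -/
theorem OmegaCP_eq_bot {n : ℕ} (hn : 3 ≤ n) : OmegaCP q n = ⊥ := by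
  obtain ⟨n, rfl⟩ := Nat.exists_eq_add_of_le' hn
  rw [eq_bot_iff]
  refine Submodule.span_le.2 ?_
  rintro _ ⟨f, g, rfl⟩
  have h : ∀ (g₁ g₂ g₃ : CP q) (w : Forms q),
      d q (incl q g₁) * (d q (incl q g₂) * (d q (incl q g₃) * w)) = 0 := by
    intro g₁ g₂ g₃ w
    obtain ⟨k, hk, e⟩ := d_incl_mul_d_incl g₁ g₂
    rw [← mul_assoc, ← mul_assoc, e, d_incl, mul_add, single_mul_of_not_disjoint (by decide),
      single_mul_of_not_disjoint (by decide), add_zero, zero_mul]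
  simp only [List.ofFn_succ, List.prod_cons, Submodule.bot_coe, Set.mem_singleton_iff]
  rw [h, mul_zero]

/-! ### The one-forms of type (1,0) and (0,1) -/

theorem OmegaHol_eq : OmegaHol q = (homog q (-2)).map (single {1}) := by
  refine le_antisymm (Submodule.span_le.2 ?_) ?_
  · rintro _ ⟨f, g, h, rfl⟩
    refine ⟨f * Xp q g * twist q {1} h, ?_, ?_⟩
    · rw [twist_one, twist_of_mem_homog (CP_mem_homog h)]
      exact mul_mem_homog' (mul_mem_homog' (CP_mem_homog f) (Xp_mem (CP_mem_homog g)) rfl)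
        (Submodule.smul_mem _ _ (CP_mem_homog h)) rfl
    · simp only [incl_apply, del_fun, single_empty_mul, single_mul_empty]
  · rintro _ ⟨y, hy, rfl⟩
    -- Only the partition of unity `∑ uᵢ X₊gᵢ = 1` is needed here: `∂` produces no `ω₋`-part to
    -- cancel.
    have key : ∀ {u g : ASU q}, u ∈ homog q 2 → g ∈ homog q 0 →
        single {1} (y * (u * Xp q g)) ∈ OmegaHol q := by
      intro u g hu hg
      refine Submodule.subset_span ⟨⟨y * u, mem_CP_iff.2 (mul_mem_homog' hy hu rfl)⟩,
        ⟨g, mem_CP_iff.2 hg⟩, 1, ?_⟩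
      rw [map_one, mul_one]
      simp only [incl_apply, del_fun, single_empty_mul, mul_assoc]
    rw [← mul_one y, ← sum_Xp_eq_one, mul_sub, mul_add, mul_smul_comm, mul_smul_comm,
      mul_smul_comm, map_sub, map_add, map_smul, map_smul, map_smul]
    refine sub_mem (add_mem (Submodule.smul_mem _ _ ?_) (Submodule.smul_mem _ _ ?_))
      (Submodule.smul_mem _ _ ?_)
    · exact key (mem_homog_two .a .a rfl) (mem_homog_two .c .as rfl)
    · exact key (mem_homog_two .c .a rfl) (mem_homog_two .c .cs rfl)
    · exact key (mem_homog_two .c .c rfl) (mem_homog_two .a .cs rfl)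

theorem OmegaAnti_eq : OmegaAnti q = (homog q 2).map (single {0}) := by
  refine le_antisymm (Submodule.span_le.2 ?_) ?_
  · rintro _ ⟨f, g, h, rfl⟩
    refine ⟨f * Xm q g * twist q {0} h, ?_, ?_⟩
    · rw [twist_zero, twist_of_mem_homog (CP_mem_homog h)]
      exact mul_mem_homog' (mul_mem_homog' (CP_mem_homog f) (Xm_mem (CP_mem_homog g)) rfl)
        (Submodule.smul_mem _ _ (CP_mem_homog h)) rfl
    · simp only [incl_apply, delbar_fun, single_empty_mul, single_mul_empty]
  · rintro _ ⟨x, hx, rfl⟩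
    have key : ∀ {u g : ASU q}, u ∈ homog q (-2) → g ∈ homog q 0 →
        single {0} (x * (u * Xm q g)) ∈ OmegaAnti q := by
      intro u g hu hg
      refine Submodule.subset_span ⟨⟨x * u, mem_CP_iff.2 (mul_mem_homog' hx hu rfl)⟩,
        ⟨g, mem_CP_iff.2 hg⟩, 1, ?_⟩
      rw [map_one, mul_one]
      simp only [incl_apply, delbar_fun, single_empty_mul, mul_assoc]
    rw [← mul_one x, ← sum_Xm_eq_one, mul_sub, mul_sub, mul_smul_comm, mul_smul_comm,
      map_sub, map_sub, map_smul, map_smul]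
    refine sub_mem (sub_mem ?_ (Submodule.smul_mem _ _ ?_)) (Submodule.smul_mem _ _ ?_)
    · exact key (mem_homog_two .cs .cs rfl) (mem_homog_two .c .as rfl)
    · exact key (mem_homog_two .as .cs rfl) (mem_homog_two .c .cs rfl)
    · exact key (mem_homog_two .as .as rfl) (mem_homog_two .a .cs rfl)

end QuantumProjectiveLine

namespace QuantumProjectiveLine

open ASU Forms

variable {q : Set.Ioo (0 : ℝ) 1}

/-! ### The bigrading -/

/-- The normal forms behind all later case distinctions; the last alternative covers the bidegrees
whose component is zero. -/
theorem mem_OmegaBi {p r : ℕ} {w : Forms q} (hw : w ∈ OmegaBi q p r) :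
    (p = 0 ∧ r = 0 ∧ ∃ f ∈ homog q 0, w = single ∅ f) ∨
    (p = 1 ∧ r = 0 ∧ ∃ y ∈ homog q (-2), w = single {1} y) ∨
    (p = 0 ∧ r = 1 ∧ ∃ x ∈ homog q 2, w = single {0} x) ∨
    (p = 1 ∧ r = 1 ∧ ∃ f ∈ homog q 0, w = single {0, 1} f) ∨ w = 0 := by
  match p, r, hw with
  | 0, 0, hw => exact Or.inl ⟨rfl, rfl, mem_OmegaCP_zero.1 hw⟩
  | 1, 0, hw =>
    have hw' : w ∈ OmegaHol q := hw
    rw [OmegaHol_eq] at hw'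
    obtain ⟨y, hy, rfl⟩ := hw'
    exact Or.inr (Or.inl ⟨rfl, rfl, y, hy, rfl⟩)
  | 0, 1, hw =>
    have hw' : w ∈ OmegaAnti q := hw
    rw [OmegaAnti_eq] at hw'
    obtain ⟨x, hx, rfl⟩ := hw'
    exact Or.inr (Or.inr (Or.inl ⟨rfl, rfl, x, hx, rfl⟩))
  | 1, 1, hw => exact Or.inr (Or.inr (Or.inr (Or.inl ⟨rfl, rfl, mem_OmegaCP_two.1 hw⟩)))
  | 0, r + 2, hw => exact Or.inr (Or.inr (Or.inr (Or.inr hw)))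
  | 1, r + 2, hw => exact Or.inr (Or.inr (Or.inr (Or.inr hw)))
  | p + 2, r, hw => exact Or.inr (Or.inr (Or.inr (Or.inr hw)))

theorem single_fun_mem_Bi {f : ASU q} (hf : f ∈ homog q 0) : single ∅ f ∈ OmegaBi q 0 0 :=
  mem_OmegaCP_zero.2 ⟨f, hf, rfl⟩
theorem single_one_mem_Bi {f : ASU q} (hf : f ∈ homog q (-2)) :
    single {1} f ∈ OmegaBi q 1 0 := by
  change _ ∈ OmegaHol q
  rw [OmegaHol_eq]
  exact ⟨f, hf, rfl⟩
theorem single_zero_mem_Bi {f : ASU q} (hf : f ∈ homog q 2) :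
    single {0} f ∈ OmegaBi q 0 1 := by
  change _ ∈ OmegaAnti q
  rw [OmegaAnti_eq]
  exact ⟨f, hf, rfl⟩
theorem single_zero_one_mem_Bi {f : ASU q} (hf : f ∈ homog q 0) :
    single {0, 1} f ∈ OmegaBi q 1 1 :=
  mem_OmegaCP_two.2 ⟨f, hf, rfl⟩

theorem actK_mem_homog {n : ℤ} {x : ASU q} (hx : x ∈ homog q n) : actK q x ∈ homog q n := by
  rw [actK_of_mem_homog hx]
  exact Submodule.smul_mem _ _ hx

theorem OmegaBi_mul_mem {p r p' r' : ℕ} {v w : Forms q} (hv : v ∈ OmegaBi q p r)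
    (hw : w ∈ OmegaBi q p' r') : v * w ∈ OmegaBi q (p + p') (r + r') := by
  have hz : ∀ {m n : ℕ} {S T : Finset (Fin 3)} (f g : ASU q), ¬ Disjoint S T →
      single S f * single T g ∈ OmegaBi q m n := fun f g h => by
    rw [single_mul_of_not_disjoint h]; exact zero_mem _
  rcases mem_OmegaBi hv with ⟨rfl, rfl, f, hf, rfl⟩ | ⟨rfl, rfl, f, hf, rfl⟩ |
    ⟨rfl, rfl, f, hf, rfl⟩ | ⟨rfl, rfl, f, hf, rfl⟩ | rfl
  · rcases mem_OmegaBi hw with ⟨rfl, rfl, g, hg, rfl⟩ | ⟨rfl, rfl, g, hg, rfl⟩ |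
      ⟨rfl, rfl, g, hg, rfl⟩ | ⟨rfl, rfl, g, hg, rfl⟩ | rfl
    · rw [single_empty_mul]; exact single_fun_mem_Bi (mul_mem_homog' hf hg rfl)
    · rw [single_empty_mul]; exact single_one_mem_Bi (mul_mem_homog' hf hg rfl)
    · rw [single_empty_mul]; exact single_zero_mem_Bi (mul_mem_homog' hf hg rfl)
    · rw [single_empty_mul]; exact single_zero_one_mem_Bi (mul_mem_homog' hf hg rfl)
    · rw [mul_zero]; exact zero_mem _
  · rcases mem_OmegaBi hw with ⟨rfl, rfl, g, hg, rfl⟩ | ⟨rfl, rfl, g, hg, rfl⟩ |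
      ⟨rfl, rfl, g, hg, rfl⟩ | ⟨rfl, rfl, g, hg, rfl⟩ | rfl
    · rw [single_mul_empty, twist_one]
      exact single_one_mem_Bi (mul_mem_homog' hf (actK_mem_homog (actK_mem_homog hg)) rfl)
    · exact hz _ _ (by decide)
    · rw [single_one_mul_zero]
      exact single_zero_one_mem_Bi (neg_mem (Submodule.smul_mem _ _
        (mul_mem_homog' hf (actK_mem_homog (actK_mem_homog hg)) rfl)))
    · exact hz _ _ (by decide)
    · rw [mul_zero]; exact zero_mem _
  · rcases mem_OmegaBi hw with ⟨rfl, rfl, g, hg, rfl⟩ | ⟨rfl, rfl, g, hg, rfl⟩ |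
      ⟨rfl, rfl, g, hg, rfl⟩ | ⟨rfl, rfl, g, hg, rfl⟩ | rfl
    · rw [single_mul_empty, twist_zero]
      exact single_zero_mem_Bi (mul_mem_homog' hf (actK_mem_homog (actK_mem_homog hg)) rfl)
    · rw [single_zero_mul_one]
      exact single_zero_one_mem_Bi
        (mul_mem_homog' hf (actK_mem_homog (actK_mem_homog hg)) rfl)
    · exact hz _ _ (by decide)
    · exact hz _ _ (by decide)
    · rw [mul_zero]; exact zero_mem _
  · rcases mem_OmegaBi hw with ⟨rfl, rfl, g, hg, rfl⟩ | ⟨rfl, rfl, g, hg, rfl⟩ |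
      ⟨rfl, rfl, g, hg, rfl⟩ | ⟨rfl, rfl, g, hg, rfl⟩ | rfl
    · rw [single_mul_empty, twist_zero_one]
      exact single_zero_one_mem_Bi (mul_mem_homog' hf (actK_mem_homog (actK_mem_homog
        (actK_mem_homog (actK_mem_homog hg)))) rfl)
    · exact hz _ _ (by decide)
    · exact hz _ _ (by decide)
    · exact hz _ _ (by decide)
    · rw [mul_zero]; exact zero_mem _
  · rw [zero_mul]; exact zero_mem _

theorem OmegaCP_eq_iSup (n : ℕ) :
    OmegaCP q n = ⨆ k ∈ Finset.HasAntidiagonal.antidiagonal n, OmegaBi q k.1 k.2 := by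
  have hle : ∀ p r : ℕ, OmegaBi q p r ≤ OmegaCP q (p + r) := by
    intro p r w hw
    rcases mem_OmegaBi hw with ⟨rfl, rfl, f, hf, rfl⟩ | ⟨rfl, rfl, f, hf, rfl⟩ |
      ⟨rfl, rfl, f, hf, rfl⟩ | ⟨rfl, rfl, f, hf, rfl⟩ | rfl
    · exact mem_OmegaCP_zero.2 ⟨f, hf, rfl⟩
    · exact single_one_mem hf
    · exact single_zero_mem hf
    · exact single_zero_one_mem hf
    · exact zero_mem _
  refine le_antisymm (fun w hw => ?_) (iSup₂_le fun k hk => ?_)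
  · have hmem : ∀ (p r : ℕ) (w : Forms q), p + r = n → w ∈ OmegaBi q p r →
        w ∈ ⨆ k ∈ Finset.HasAntidiagonal.antidiagonal n, OmegaBi q k.1 k.2 :=
      fun p r w h hw => (le_iSup₂ (f := fun (k : ℕ × ℕ)
        (_ : k ∈ Finset.HasAntidiagonal.antidiagonal n) => OmegaBi q k.1 k.2) (p, r)
        (Finset.HasAntidiagonal.mem_antidiagonal.2 h)) hw
    match n, hw with
    | 0, hw => exact hmem 0 0 w rfl hw
    | 1, hw =>
      obtain ⟨x, hx, y, hy, rfl⟩ := mem_OmegaCP_one.1 hw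
      exact add_mem (hmem 0 1 _ rfl (single_zero_mem_Bi hx)) (hmem 1 0 _ rfl (single_one_mem_Bi hy))
    | 2, hw => exact hmem 1 1 w rfl hw
    | n + 3, hw =>
      rw [OmegaCP_eq_bot (by omega)] at hw
      rw [(Submodule.mem_bot ℂ).1 hw]
      exact zero_mem _
  · rw [← Finset.HasAntidiagonal.mem_antidiagonal.1 hk]
    exact hle _ _

/-- Additive statements about n-forms are thereby reduced to bihomogeneous forms, hence to a single
coefficient times one of `1`, `ω₋`, `ω₊`, `ω₋ ∧ ω₊`. -/
theorem OmegaCP_induction {n : ℕ} {P : Forms q → Prop} (hzero : P 0)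
    (hadd : ∀ v w, P v → P w → P (v + w))
    (hBi : ∀ p r w, p + r = n → w ∈ OmegaBi q p r → P w) {w : Forms q} (hw : w ∈ OmegaCP q n) :
    P w := by
  rw [OmegaCP_eq_iSup] at hw
  refine Submodule.iSup_induction _ (motive := P) hw (fun k v hv => ?_) hzero hadd
  refine Submodule.iSup_induction _ (motive := P) hv (fun hk u hu => ?_) hzero hadd
  exact hBi k.1 k.2 u (Finset.HasAntidiagonal.mem_antidiagonal.1 hk) hu

theorem OmegaBi_le {p r n : ℕ} (h : p + r = n) : OmegaBi q p r ≤ OmegaCP q n := by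
  rw [OmegaCP_eq_iSup]
  exact le_iSup₂_of_le (p, r) (Finset.HasAntidiagonal.mem_antidiagonal.2 h) le_rfl

/-- Subspaces of forms with pairwise disjoint supports are independent. -/
theorem iSupIndep_of_support {ι : Type*} (τ : Finset (Fin 3) → ι) (V : ι → Submodule ℂ (Forms q))
    (hV : ∀ i, ∀ w ∈ V i, ∀ S, τ S ≠ i → coef S w = 0) : iSupIndep V := by
  intro i
  rw [Submodule.disjoint_def]
  intro w hw hw'
  have key : ⨆ j ≠ i, V j ≤ ⨅ (S : Finset (Fin 3)) (_ : τ S = i), LinearMap.ker (coef (q := q) S) := by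
    refine iSup₂_le fun j hj v hv => ?_
    simp only [Submodule.mem_iInf, LinearMap.mem_ker]
    intro S hS
    exact hV j v hv S (fun h => hj (h.symm.trans hS))
  have h := key hw'
  simp only [Submodule.mem_iInf, LinearMap.mem_ker] at h
  refine ext_coef fun S => ?_
  rw [map_zero]
  by_cases hS : τ S = i
  · exact h S hS
  · exact hV i w hw S hS

theorem OmegaBi_independent : iSupIndep fun k : ℕ × ℕ => OmegaBi q k.1 k.2 := by
  -- The label of `S` counts the factors `ω₊` and `ω₋`. The index of `ω_z` may be ignored, since
  -- membership only has to force zero coefficients at differently labelled sets.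
  refine iSupIndep_of_support
    (fun S => ((if 1 ∈ S then 1 else 0 : ℕ), (if 0 ∈ S then 1 else 0 : ℕ))) _ ?_
  rintro ⟨p, r⟩ w hw S hS
  rcases mem_OmegaBi hw with ⟨rfl, rfl, f, hf, rfl⟩ | ⟨rfl, rfl, f, hf, rfl⟩ |
    ⟨rfl, rfl, f, hf, rfl⟩ | ⟨rfl, rfl, f, hf, rfl⟩ | rfl
  · exact coef_single_ne (by rintro rfl; exact hS rfl) f
  · exact coef_single_ne (by rintro rfl; exact hS rfl) f
  · exact coef_single_ne (by rintro rfl; exact hS rfl) f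
  · exact coef_single_ne (by rintro rfl; exact hS rfl) f
  · exact map_zero _

theorem OmegaCP_independent : iSupIndep (OmegaCP q) := by
  refine iSupIndep_of_support (fun S => S.card) _ fun n w hw => ?_
  refine OmegaCP_induction (P := fun w => ∀ S : Finset (Fin 3), S.card ≠ n → coef S w = 0)
    (fun _ _ => map_zero _) (fun v w hv hw S hS => by rw [map_add, hv S hS, hw S hS, add_zero])
    (fun p r w hpr hw S hS => ?_) hw
  rcases mem_OmegaBi hw with ⟨rfl, rfl, f, hf, rfl⟩ | ⟨rfl, rfl, f, hf, rfl⟩ |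
    ⟨rfl, rfl, f, hf, rfl⟩ | ⟨rfl, rfl, f, hf, rfl⟩ | rfl
  · exact coef_single_ne (by rintro rfl; exact hS hpr) f
  · exact coef_single_ne (by rintro rfl; exact hS hpr) f
  · exact coef_single_ne (by rintro rfl; exact hS hpr) f
  · exact coef_single_ne (by rintro rfl; exact hS hpr) f
  · exact map_zero _

/-! ### The operators `∂` and `∂̄` on the projective line -/

theorem del_mem {p r : ℕ} {w : Forms q} (hw : w ∈ OmegaBi q p r) :
    del q w ∈ OmegaBi q (p + 1) r := by
  rcases mem_OmegaBi hw with ⟨rfl, rfl, f, hf, rfl⟩ | ⟨rfl, rfl, f, hf, rfl⟩ |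
    ⟨rfl, rfl, f, hf, rfl⟩ | ⟨rfl, rfl, f, hf, rfl⟩ | rfl
  · rw [del_fun]; exact single_one_mem_Bi (Xp_mem hf)
  · rw [del_one]; exact zero_mem _
  · rw [del_zero]
    exact single_zero_one_mem_Bi (neg_mem (Submodule.smul_mem _ _ (Xp_mem_zero hf)))
  · rw [del_zero_one]; exact zero_mem _
  · rw [map_zero]; exact zero_mem _

theorem delbar_mem {p r : ℕ} {w : Forms q} (hw : w ∈ OmegaBi q p r) :
    delbar q w ∈ OmegaBi q p (r + 1) := by
  rcases mem_OmegaBi hw with ⟨rfl, rfl, f, hf, rfl⟩ | ⟨rfl, rfl, f, hf, rfl⟩ |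
    ⟨rfl, rfl, f, hf, rfl⟩ | ⟨rfl, rfl, f, hf, rfl⟩ | rfl
  · rw [delbar_fun]; exact single_zero_mem_Bi (Xm_mem hf)
  · rw [delbar_one]; exact single_zero_one_mem_Bi (Xm_mem_zero hf)
  · rw [delbar_zero]; exact zero_mem _
  · rw [delbar_zero_one]; exact zero_mem _
  · rw [map_zero]; exact zero_mem _

theorem del_del {p r : ℕ} {w : Forms q} (hw : w ∈ OmegaBi q p r) : del q (del q w) = 0 := by
  rcases mem_OmegaBi hw with ⟨rfl, rfl, f, hf, rfl⟩ | ⟨rfl, rfl, f, hf, rfl⟩ |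
    ⟨rfl, rfl, f, hf, rfl⟩ | ⟨rfl, rfl, f, hf, rfl⟩ | rfl <;>
  simp only [del_fun, del_one, del_zero, del_zero_one, map_zero]

theorem delbar_delbar {p r : ℕ} {w : Forms q} (hw : w ∈ OmegaBi q p r) :
    delbar q (delbar q w) = 0 := by
  rcases mem_OmegaBi hw with ⟨rfl, rfl, f, hf, rfl⟩ | ⟨rfl, rfl, f, hf, rfl⟩ |
    ⟨rfl, rfl, f, hf, rfl⟩ | ⟨rfl, rfl, f, hf, rfl⟩ | rfl <;>
  simp only [delbar_fun, delbar_one, delbar_zero, delbar_zero_one, map_zero]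

theorem del_delbar_add {p r : ℕ} {w : Forms q} (hw : w ∈ OmegaBi q p r) :
    del q (delbar q w) + delbar q (del q w) = 0 := by
  rcases mem_OmegaBi hw with ⟨rfl, rfl, f, hf, rfl⟩ | ⟨rfl, rfl, f, hf, rfl⟩ |
    ⟨rfl, rfl, f, hf, rfl⟩ | ⟨rfl, rfl, f, hf, rfl⟩ | rfl
  -- Only functions give a nontrivial case: the sum is `(X₋X₊ - q²X₊X₋)f = X_z f` times `ω₋ ∧ ω₊`,
  -- and `X_z` vanishes in degree 0.
  · have h := Xm_Xp_comm f
    rw [Xz_of_mem_homog hf] at h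
    simp only [mul_zero, zpow_zero, sub_self, zero_div, zero_smul] at h
    rw [delbar_fun, del_fun, del_zero, delbar_one, ← map_add, neg_add_eq_sub, h, map_zero]
  all_goals simp only [del_fun, del_one, del_zero, del_zero_one, delbar_fun, delbar_one,
    delbar_zero, delbar_zero_one, map_zero, add_zero]

/-- The twist `K²` in the Leibniz rule of `X₊` matches the one produced by passing through `ω_±`.
For `f ω₋` times a function, `K²X₊ = q²X₊K²` supplies the `q²` that reordering the two one-forms
introduces on the other side. -/
theorem del_leibniz {p r p' r' : ℕ} {v w : Forms q} (hv : v ∈ OmegaBi q p r)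
    (hw : w ∈ OmegaBi q p' r') :
    del q (v * w) = del q v * w + (-1 : ℂ) ^ (p + r) • (v * del q w) := by
  have hQ := Q_ne q
  rcases mem_OmegaBi hv with ⟨rfl, rfl, f, hf, rfl⟩ | ⟨rfl, rfl, f, hf, rfl⟩ |
    ⟨rfl, rfl, f, hf, rfl⟩ | ⟨rfl, rfl, f, hf, rfl⟩ | rfl <;>
  rcases mem_OmegaBi hw with ⟨rfl, rfl, g, hg, rfl⟩ | ⟨rfl, rfl, g, hg, rfl⟩ |
    ⟨rfl, rfl, g, hg, rfl⟩ | ⟨rfl, rfl, g, hg, rfl⟩ | rfl <;>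
  simp only [single_empty_mul, single_mul_empty, single_zero_mul_one, single_one_mul_zero,
    single_mul_zero_zero, single_mul_one_one, single_mul_zero_top, single_mul_one_top,
    single_mul_top_zero, single_mul_top_one, single_mul_top_top, twist_empty, twist_zero, twist_one,
    twist_zero_one, Xp_mul, actK_sq_apply, actK_Xp, map_smul, map_add, map_neg, smul_smul,
    mul_neg, neg_mul, mul_smul_comm, smul_mul_assoc, smul_neg, smul_add,
    del_fun, del_one, del_zero, del_zero_one, map_zero, mul_zero, zero_mul, smul_zero, add_zero,
    zero_add, pow_zero, pow_one, one_smul]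
  all_goals module

theorem delbar_leibniz {p r p' r' : ℕ} {v w : Forms q} (hv : v ∈ OmegaBi q p r)
    (hw : w ∈ OmegaBi q p' r') :
    delbar q (v * w) = delbar q v * w + (-1 : ℂ) ^ (p + r) • (v * delbar q w) := by
  have hQ := Q_ne q
  rcases mem_OmegaBi hv with ⟨rfl, rfl, f, hf, rfl⟩ | ⟨rfl, rfl, f, hf, rfl⟩ |
    ⟨rfl, rfl, f, hf, rfl⟩ | ⟨rfl, rfl, f, hf, rfl⟩ | rfl <;>
  rcases mem_OmegaBi hw with ⟨rfl, rfl, g, hg, rfl⟩ | ⟨rfl, rfl, g, hg, rfl⟩ |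
    ⟨rfl, rfl, g, hg, rfl⟩ | ⟨rfl, rfl, g, hg, rfl⟩ | rfl <;>
  simp only [single_empty_mul, single_mul_empty, single_zero_mul_one, single_one_mul_zero,
    single_mul_zero_zero, single_mul_one_one, single_mul_zero_top, single_mul_one_top,
    single_mul_top_zero, single_mul_top_one, single_mul_top_top, twist_empty, twist_zero, twist_one,
    twist_zero_one, Xm_mul, actK_sq_apply, actK_Xm, map_smul, map_add, map_neg, smul_smul,
    mul_neg, neg_mul, mul_smul_comm, smul_mul_assoc, smul_neg, smul_add,
    delbar_fun, delbar_one, delbar_zero, delbar_zero_one, map_zero, mul_zero, zero_mul, smul_zero,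
    add_zero, zero_add, pow_zero, pow_one, one_smul, neg_zero]
  all_goals first | abel1 | (match_scalars <;> field_simp)

/-! ### The involution -/

theorem star_mem_homog' {m n : ℤ} {x : ASU q} (hx : x ∈ homog q n) (h : -n = m) :
    star x ∈ homog q m := h ▸ star_mem_homog hx

theorem st_mem {p r : ℕ} {w : Forms q} (hw : w ∈ OmegaBi q p r) : st q w ∈ OmegaBi q r p := by
  rcases mem_OmegaBi hw with ⟨rfl, rfl, f, hf, rfl⟩ | ⟨rfl, rfl, f, hf, rfl⟩ |
    ⟨rfl, rfl, f, hf, rfl⟩ | ⟨rfl, rfl, f, hf, rfl⟩ | rfl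
  · rw [st_fun]; exact single_fun_mem_Bi (star_mem_homog' hf rfl)
  · rw [st_one]
    exact single_zero_mem_Bi (neg_mem (actK_mem_homog (actK_mem_homog (star_mem_homog' hf rfl))))
  · rw [st_zero]
    exact single_one_mem_Bi (neg_mem (actK_mem_homog (actK_mem_homog (star_mem_homog' hf rfl))))
  · rw [st_zero_one]
    exact single_zero_one_mem_Bi (neg_mem (actK_mem_homog (actK_mem_homog (actK_mem_homog
      (actK_mem_homog (star_mem_homog' hf rfl))))))
  · rw [map_zero]; exact zero_mem _

theorem st_st {p r : ℕ} {w : Forms q} (hw : w ∈ OmegaBi q p r) : st q (st q w) = w := by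
  rcases mem_OmegaBi hw with ⟨rfl, rfl, f, hf, rfl⟩ | ⟨rfl, rfl, f, hf, rfl⟩ |
    ⟨rfl, rfl, f, hf, rfl⟩ | ⟨rfl, rfl, f, hf, rfl⟩ | rfl <;>
  simp only [st_fun, st_zero, st_one, st_zero_one, star_neg, map_neg, star_actK, star_star, neg_neg,
    map_zero]

theorem st_mul {p r p' r' : ℕ} {v w : Forms q} (hv : v ∈ OmegaBi q p r)
    (hw : w ∈ OmegaBi q p' r') :
    st q (v * w) = (-1 : ℂ) ^ ((p + r) * (p' + r')) • (st q w * st q v) := by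
  have hc : star (Q q) = Q q := conj_Q q
  rcases mem_OmegaBi hv with ⟨rfl, rfl, f, hf, rfl⟩ | ⟨rfl, rfl, f, hf, rfl⟩ |
    ⟨rfl, rfl, f, hf, rfl⟩ | ⟨rfl, rfl, f, hf, rfl⟩ | rfl <;>
  rcases mem_OmegaBi hw with ⟨rfl, rfl, g, hg, rfl⟩ | ⟨rfl, rfl, g, hg, rfl⟩ |
    ⟨rfl, rfl, g, hg, rfl⟩ | ⟨rfl, rfl, g, hg, rfl⟩ | rfl <;>
  simp only [single_empty_mul, single_mul_empty, single_zero_mul_one, single_one_mul_zero,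
    single_mul_zero_zero, single_mul_one_one, single_mul_zero_top, single_mul_one_top,
    single_mul_top_zero, single_mul_top_one, single_mul_top_top, twist_empty, twist_zero, twist_one,
    twist_zero_one, st_fun, st_zero, st_one, st_zero_one, star_mul, map_mul, star_neg, star_smul,
    star_pow, hc, map_neg, map_smul, star_actK, mul_neg, neg_mul, mul_smul_comm, smul_mul_assoc,
    smul_neg, map_zero, mul_zero, zero_mul, smul_zero, pow_zero, pow_one, one_smul, neg_neg,
    LinearMap.map_smulₛₗ, map_pow, conj_Q, add_zero, zero_add, mul_one,
    neg_zero]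
  all_goals module

/-- Commuting `K²` past `X₋` produces the `q²` that matches the reordering factor in `∂(f ω₋)`. -/
theorem Xm_neg_actK_actK (x : ASU q) :
    Xm q (-(actK q (actK q x))) = -(Q q ^ 2 • actK q (actK q (Xm q x))) := by
  have hQ := Q_ne q
  have h : Q q ^ 2 * (Q q)⁻¹ * (Q q)⁻¹ = 1 := by field_simp
  rw [actK_Xm, map_smul, actK_Xm, smul_smul, smul_smul, h, one_smul, map_neg]

theorem st_del {p r : ℕ} {w : Forms q} (hw : w ∈ OmegaBi q p r) :
    st q (del q w) = delbar q (st q w) := by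
  have hQ := Q_ne q
  have hc : star (Q q) = Q q := conj_Q q
  rcases mem_OmegaBi hw with ⟨rfl, rfl, f, hf, rfl⟩ | ⟨rfl, rfl, f, hf, rfl⟩ |
    ⟨rfl, rfl, f, hf, rfl⟩ | ⟨rfl, rfl, f, hf, rfl⟩ | rfl <;>
  simp only [del_fun, del_one, del_zero, del_zero_one, st_fun, st_zero, st_one, st_zero_one,
    delbar_fun, delbar_one, delbar_zero, delbar_zero_one, map_zero, Xm_star, actK_sq_apply]
  -- Only forms `f ω₋` remain; on functions the claim was `Xm_star` itself.
  rw [Xm_neg_actK_actK, Xm_star]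
  simp only [star_neg, star_smul, star_pow, hc, map_neg, map_smul, neg_neg, actK_sq_apply, smul_neg]

/-- The conjugate of `st_del`, obtained by applying the involution twice. -/
theorem st_delbar {p r : ℕ} {w : Forms q} (hw : w ∈ OmegaBi q p r) :
    st q (delbar q w) = del q (st q w) := by
  have h := st_del (st_mem hw)
  rw [st_st hw] at h
  rw [← h, st_st (del_mem (st_mem hw))]

theorem d_eq_del_add_delbar {n : ℕ} {w : Forms q} (hw : w ∈ OmegaCP q n) :
    d q w = del q w + delbar q w := by
  refine OmegaCP_induction (P := fun w => d q w = del q w + delbar q w) (by simp)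
    (fun v w hv hw => by rw [map_add, map_add, map_add, hv, hw]; abel)
    (fun p r w _ hw => ?_) hw
  rcases mem_OmegaBi hw with ⟨rfl, rfl, f, hf, rfl⟩ | ⟨rfl, rfl, f, hf, rfl⟩ |
    ⟨rfl, rfl, f, hf, rfl⟩ | ⟨rfl, rfl, f, hf, rfl⟩ | rfl
  · exact d_eq_fun hf
  · exact d_eq_one hf
  · exact d_eq_zero hf
  · exact d_eq_zero_one hf
  · simp

theorem isComplexStructure :
    IsComplexStructure (OmegaCP q) (d q) (st q) (OmegaBi q) (del q) (delbar q) where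
  one_mem := single_fun_mem_Bi one_mem_homog
  mul_mem _ _ _ _ _ _ hx hy := OmegaBi_mul_mem hx hy
  independent := OmegaBi_independent
  sum_eq := OmegaCP_eq_iSup
  del_mem _ _ _ hx := del_mem hx
  delbar_mem _ _ _ hx := delbar_mem hx
  del_del _ _ _ hx := del_del hx
  delbar_delbar _ _ _ hx := delbar_delbar hx
  del_leibniz _ _ _ _ _ _ hx hy := del_leibniz hx hy
  delbar_leibniz _ _ _ _ _ _ hx hy := delbar_leibniz hx hy
  d_eq _ _ hx := d_eq_del_add_delbar hx
  star_mem _ _ _ hx := st_mem hx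
  star_del _ _ _ hx := st_del hx

/-! ### The differential `*`-calculus -/

theorem OmegaCP_mul_mem {m n : ℕ} {v w : Forms q} (hv : v ∈ OmegaCP q m)
    (hw : w ∈ OmegaCP q n) : v * w ∈ OmegaCP q (m + n) := by
  refine OmegaCP_induction (P := fun v => v * w ∈ OmegaCP q (m + n)) (by simp)
    (fun v v' h h' => by rw [add_mul]; exact add_mem h h') (fun p r v hpr hv => ?_) hv
  refine OmegaCP_induction (P := fun w => v * w ∈ OmegaCP q (m + n)) (by simp)
    (fun w w' h h' => by rw [mul_add]; exact add_mem h h') (fun p' r' w hpr' hw => ?_) hw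
  exact OmegaBi_le (by omega) (OmegaBi_mul_mem hv hw)

theorem d_leibniz {m n : ℕ} {v w : Forms q} (hv : v ∈ OmegaCP q m) (hw : w ∈ OmegaCP q n) :
    d q (v * w) = d q v * w + (-1 : ℂ) ^ m • (v * d q w) := by
  rw [d_eq_del_add_delbar (OmegaCP_mul_mem hv hw), d_eq_del_add_delbar hv, d_eq_del_add_delbar hw]
  refine OmegaCP_induction (P := fun v => del q (v * w) + delbar q (v * w)
      = (del q v + delbar q v) * w + (-1 : ℂ) ^ m • (v * (del q w + delbar q w))) (by simp)
    (fun v v' h h' => by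
      simp only [add_mul, map_add, mul_add, smul_add] at h h' ⊢
      rw [add_add_add_comm, h, h']; abel) (fun p r v hpr hv => ?_) hv
  refine OmegaCP_induction (P := fun w => del q (v * w) + delbar q (v * w)
      = (del q v + delbar q v) * w + (-1 : ℂ) ^ m • (v * (del q w + delbar q w))) (by simp)
    (fun w w' h h' => by
      simp only [add_mul, map_add, mul_add, smul_add] at h h' ⊢
      rw [add_add_add_comm, h, h']; abel) (fun p' r' w hpr' hw => ?_) hw
  rw [del_leibniz hv hw, delbar_leibniz hv hw, hpr, add_mul, mul_add, smul_add]
  abel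

theorem isDifferentialStarCalculus :
    IsDifferentialStarCalculus (incl q) (OmegaCP q) (d q) (st q) where
  injective f g h := by
    have h' := congrArg (coef ∅) h
    rw [incl_apply, incl_apply, coef_single_same, coef_single_same] at h'
    exact Subtype.ext h'
  zero_eq := by
    ext w
    rw [mem_OmegaCP_zero]
    constructor
    · rintro ⟨f, hf, rfl⟩
      exact ⟨⟨f, mem_CP_iff.2 hf⟩, rfl⟩
    · rintro ⟨f, rfl⟩
      exact ⟨f, CP_mem_homog f, rfl⟩
  independent := OmegaCP_independent
  mul_mem _ _ _ _ hx hy := OmegaCP_mul_mem hx hy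
  d_mem n x hx := by
    rw [d_eq_del_add_delbar hx]
    refine OmegaCP_induction (P := fun w => del q w + delbar q w ∈ OmegaCP q (n + 1)) (by simp)
      (fun v w hv hw => by
        rw [map_add, map_add, add_add_add_comm]; exact add_mem hv hw) (fun p r w hpr hw => ?_) hx
    exact add_mem (OmegaBi_le (by omega) (del_mem hw)) (OmegaBi_le (by omega) (delbar_mem hw))
  leibniz _ _ _ _ hx hy := d_leibniz hx hy
  d_d n x hx := by
    refine OmegaCP_induction (P := fun w => d q (d q w) = 0) (by simp)
      (fun v w hv hw => by rw [map_add, map_add, hv, hw, add_zero]) (fun p r w hpr hw => ?_) hx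
    -- Expanding `(∂ + ∂̄)²` requires the splitting of the differential again on `∂w` and `∂̄w`,
    -- which is available because both are bihomogeneous.
    rw [d_eq_del_add_delbar (OmegaBi_le rfl hw), map_add,
      d_eq_del_add_delbar (OmegaBi_le rfl (del_mem hw)),
      d_eq_del_add_delbar (OmegaBi_le rfl (delbar_mem hw)), del_del hw, delbar_delbar hw, zero_add,
      add_zero, add_comm, del_delbar_add hw]
  star_of a := st_fun _
  star_mem n x hx := by
    refine OmegaCP_induction (P := fun w => st q w ∈ OmegaCP q n) (by simp)
      (fun v w hv hw => by rw [map_add]; exact add_mem hv hw) (fun p r w hpr hw => ?_) hx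
    exact OmegaBi_le (by omega) (st_mem hw)
  star_star n x hx := by
    refine OmegaCP_induction (P := fun w => st q (st q w) = w) (by simp)
      (fun v w hv hw => by rw [map_add, map_add, hv, hw]) (fun p r w hpr hw => st_st hw) hx
  star_mul m n x y hx hy := by
    refine OmegaCP_induction (P := fun x => st q (x * y) = (-1 : ℂ) ^ (m * n) • (st q y * st q x))
      (by simp) (fun v w hv hw => by rw [add_mul, map_add, map_add, mul_add, smul_add, hv, hw])
      (fun p r v hpr hv => ?_) hx
    refine OmegaCP_induction (P := fun y => st q (v * y) = (-1 : ℂ) ^ (m * n) • (st q y * st q v))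
      (by simp) (fun v w hv hw => by rw [mul_add, map_add, map_add, add_mul, smul_add, hv, hw])
      (fun p' r' w hpr' hw => ?_) hy
    rw [st_mul hv hw, hpr, hpr']
  d_star n x hx := by
    refine OmegaCP_induction (P := fun w => d q (st q w) = st q (d q w)) (by simp)
      (fun v w hv hw => by simp only [map_add, hv, hw]) (fun p r w hpr hw => ?_) hx
    rw [d_eq_del_add_delbar (OmegaBi_le rfl hw), d_eq_del_add_delbar (OmegaBi_le rfl (st_mem hw)),
      map_add, st_del hw, st_delbar hw, add_comm]

/-! ### Left covariance -/

/-- The coproduct keeps the second leg in degree k, so it suffices that all coefficients of degree k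
are admissible at `ω_S`. -/
theorem coaction_single_mem {n : ℕ} {k : ℤ} {S : Finset (Fin 3)}
    (h : ∀ f ∈ homog q k, single S f ∈ OmegaCP q n) {f : ASU q} (hf : f ∈ homog q k) :
    coaction q (single S f) ∈ LinearMap.range ((OmegaCP q n).subtype.lTensor (ASU q)) := by
  rw [coaction_single]
  obtain ⟨t, ht⟩ := comul_mem_homog hf
  rw [← ht]
  clear ht
  induction t using TensorProduct.induction_on with
  | zero => simp
  | add t t' ht ht' => rw [map_add, map_add]; exact add_mem ht ht'
  | tmul x y => exact ⟨x ⊗ₜ ⟨_, h y y.2⟩, by simp⟩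

theorem isLeftCovariant : IsLeftCovariant q where
  coact_mem n x hx := by
    refine OmegaCP_induction (P := fun w => coaction q w
        ∈ LinearMap.range ((OmegaCP q n).subtype.lTensor (ASU q))) (by simp)
      (fun v w hv hw => by rw [map_add]; exact add_mem hv hw) (fun p r w hpr hw => ?_) hx
    rcases mem_OmegaBi hw with ⟨rfl, rfl, f, hf, rfl⟩ | ⟨rfl, rfl, f, hf, rfl⟩ |
      ⟨rfl, rfl, f, hf, rfl⟩ | ⟨rfl, rfl, f, hf, rfl⟩ | rfl
    · exact coaction_single_mem (fun g hg => OmegaBi_le hpr (single_fun_mem_Bi hg)) hf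
    · exact coaction_single_mem (fun g hg => OmegaBi_le hpr (single_one_mem_Bi hg)) hf
    · exact coaction_single_mem (fun g hg => OmegaBi_le hpr (single_zero_mem_Bi hg)) hf
    · exact coaction_single_mem (fun g hg => OmegaBi_le hpr (single_zero_one_mem_Bi hg)) hf
    · rw [map_zero]; exact zero_mem _
  coact_fun f := coaction_single ∅ (f : ASU q)
  coact_mul _ _ x y _ _ := coaction_mul x y
  coact_d _ x _ := coaction_d x

/-! ### The components as line bundles -/

theorem CP_toSubmodule : (CP q).toSubalgebra.toSubmodule = homog q 0 := by
  ext x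
  exact mem_CP_iff

theorem timesForm_single (L : Submodule ℂ (ASU q)) (S : Finset (Fin 3)) :
    timesForm q L (single S 1) = L.map (single S) := by
  rw [timesForm]
  congr 1
  refine LinearMap.ext fun f => ?_
  change single ∅ f * single S 1 = single S f
  rw [single_empty_mul, mul_one]

end QuantumProjectiveLine

/-! ### Assembly of the proposition -/

theorem mainTheorem6 (q : Set.Ioo (0 : ℝ) 1) :
    -- the restricted calculus is a left-covariant differential `*`-calculus on the projective line
    IsDifferentialStarCalculus (incl q) (OmegaCP q) (Forms.d q) (Forms.st q) ∧
    IsLeftCovariant q ∧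
    -- its homogeneous components
    OmegaCP q 0 = timesForm q (CP q).toSubalgebra.toSubmodule 1 ∧
    OmegaCP q 1 = timesForm q (lineBundle q (-2)) (Forms.om q 0) ⊔
      timesForm q (lineBundle q 2) (Forms.om q 1) ∧
    Disjoint (timesForm q (lineBundle q (-2)) (Forms.om q 0))
      (timesForm q (lineBundle q 2) (Forms.om q 1)) ∧
    OmegaCP q 2 = timesForm q (CP q).toSubalgebra.toSubmodule (Forms.om q 0 * Forms.om q 1) ∧
    (∀ n, 3 ≤ n → OmegaCP q n = ⊥) ∧
    -- the splitting of the one-forms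
    OmegaHol q = timesForm q (lineBundle q 2) (Forms.om q 1) ∧
    OmegaAnti q = timesForm q (lineBundle q (-2)) (Forms.om q 0) ∧
    -- the complex structure
    IsComplexStructure (OmegaCP q) (Forms.d q) (Forms.st q) (OmegaBi q)
      (Forms.del q) (Forms.delbar q) := by
  -- All coefficient spaces become graded pieces; because of the sign in `lineBundle_eq`, the
  -- bundles of index -2 and 2 are the pieces of degree 2 and -2.
  rw [CP_toSubmodule, ASU.lineBundle_eq, ASU.lineBundle_eq, Forms.om_zero_one, Forms.om, Forms.om,
    Forms.one_def, timesForm_single, timesForm_single, timesForm_single, timesForm_single]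
  refine ⟨isDifferentialStarCalculus, isLeftCovariant, ?_, ?_, ?_, ?_, fun n hn => OmegaCP_eq_bot hn,
    OmegaHol_eq, OmegaAnti_eq, isComplexStructure⟩
  · ext w
    rw [mem_OmegaCP_zero, Submodule.mem_map]
    simp only [eq_comm]
  · ext w
    rw [mem_OmegaCP_one, Submodule.mem_sup]
    constructor
    · rintro ⟨x, hx, y, hy, rfl⟩
      exact ⟨_, ⟨x, hx, rfl⟩, _, ⟨y, hy, rfl⟩, rfl⟩
    · rintro ⟨_, ⟨x, hx, rfl⟩, _, ⟨y, hy, rfl⟩, rfl⟩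
      exact ⟨x, hx, y, hy, rfl⟩
  · rw [Submodule.disjoint_def]
    rintro _ ⟨x, _, rfl⟩ ⟨y, _, h⟩
    have h' := congrArg (Forms.coef {0}) h
    rw [Forms.coef_single_ne (by decide), Forms.coef_single_same] at h'
    rw [← h', map_zero]
  · ext w
    rw [mem_OmegaCP_two, Submodule.mem_map]
    simp only [eq_comm]
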